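/- Let $m=2r$ with $r\ge 1$, let $n\ge 1$, $0\le k\le n$, and let $V=\mathbf F_2^m$, $N=\mathbf F_2^n$. Put $$X=x_1x_2+\cdots+x_{m-1}x_m,\qquad Y=x_1x_2+\cdots+x_{m-3}x_{m-2}+x_{m-1}^2+x_{m-1}x_m+x_m^2,$$ the standard quadratic forms over $\mathbf F_2$ in $m$ variables of Arf invariant $+1$ and $-1$ respectively. Let $E: N\to G\to V$ be a central extension whose class in $H^2(V;N)=H^2(V;\mathbf F_2)^n$, with $H^*(V;\mathbf F_2)=\mathbf F_2[x_1,\dots,x_m]$, is $$[E]=(X_1,\dots,X_n),\qquad X_1=\cdots=X_k=X,\quad X_{k+1}=\cdots=X_n=Y.$$ The group $Aut(V)\times Aut(N)$ acts on $H^2(V;N)$ by $(\sigma,\tau)\cdot c=\tau_*(\sigma^{-1})^*c$. Let $Aut(V)_{[E]}$ and $Aut(N)_{[E]}$ be the isotropy groups of $[E]$, let $\Omega([E])=(Aut(V)\cdot[E])\cap(Aut(N)\cdot[E])$ be the intersection of its orbits, let $Aut_N(G)$ be the group of automorphisms of $G$ that map $N$ onto itself, and let $\rho: Aut_N(G)\to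 Aut(V)\times Aut(N)$ send an automorphism to the pair of automorphisms it induces. Identify $Aut(V)$ with $GL_m(\mathbf F_2)$ by letting $A$ act as $v\mapsto Av$ on column vectors, and $Aut(N)$ with $GL_n(\mathbf F_2)$ by letting $T$ act as $v\mapsto vT^{-1}$ on row vectors, so that $T$ sends $[E]$ to the matrix product $[E]\,T^{-1}$. Let $O_m^+(\mathbf F_2)$ and $O_m^-(\mathbf F_2)$ be the groups of matrices in $GL_m(\mathbf F_2)$ that preserve $X$ and $Y$ respectively, and let $\sim$ denote conjugacy of subgroups of $GL_n(\mathbf F_2)$. Then $\Omega([E])=\{[E]\}$ and $|Im(\rho)|=|Aut(V)_{[E]}|\cdot|Aut(N)_{[E]}|$. Furthermore: 1) If $k=n$, then $Aut(V)_{[E]}=O_m^+(\mathbf F_2)$, of order $2(2^r-1)\prod_{i=1}^{r-1}(2^{2i}-1)2^{2i}$, and $$Aut(N)_{[E]}\sim\begin{pmatrix}1&0\\ *&GL_{n-1}(\mathbf F_2)\end{pmatrix},$$ of order $2^{n-1}\prod_{i=1}^{n-1}(2^i-1)2^{i-1}$. $Im(\rho)$ is a $2$-group if and only if $m,n<3$.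 2) If $k=0$, then $Aut(V)_{[E]}=O_m^-(\mathbf F_2)$, of order $2(2^r+1)\prod_{i=1}^{r-1}(2^{2i}-1)2^{2i}$, and $$Aut(N)_{[E]}\sim\begin{pmatrix}1&0\\ *&GL_{n-1}(\mathbf F_2)\end{pmatrix}.$$ $Im(\rho)$ is a $2$-group if and only if $m<2$ and $n<3$; since $m\ge 2$, this means that $Im(\rho)$ is never a $2$-group. 3) If $1\le k<n$, then $Aut(V)_{[E]}=O_m^+(\mathbf F_2)\cap O_m^-(\mathbf F_2)$ and $$Aut(N)_{[E]}\sim\begin{pmatrix}I_2&0\\ *&GL_{n-2}(\mathbf F_2)\end{pmatrix},$$ of order $2^{2(n-2)}\prod_{i=1}^{n-2}(2^i-1)2^{i-1}$. $Im(\rho)$ is a $2$-group if and only if $m,n<4$. -/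

import Mathlib

/-! ## Intersection of orbits and isotropy groups for a product of two groups -/

section Orbits

/-- The intersection orbit `Ω(x)`: the intersection of the orbit of `x` under `A` with the orbit of
`x` under `B`. The second orbit is the same for the left action of `B` and for the right action
`x * b = b⁻¹ • x`. -/
def intersectionOrbit (A B : Type*) {X : Type*} [Group A] [Group B] [MulAction (A × B) X]
    (x : X) : Set X :=
  (Set.range fun a : A => ((a, 1) : A × B) • x) ∩ (Set.range fun b : B => ((1, b) : A × B) • x)

/-- The isotropy group `A_x` of `x` under the first factor. -/
def isotropyLeft (A B : Type*) {X : Type*} [Group A] [Group B] [MulAction (A × B) X]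
    (x : X) : Subgroup A :=
  (MulAction.stabilizer (A × B) x).comap (MonoidHom.inl A B)

/-- The isotropy group `B_x` of `x` under the second factor. -/
def isotropyRight (A B : Type*) {X : Type*} [Group A] [Group B] [MulAction (A × B) X]
    (x : X) : Subgroup B :=
  (MulAction.stabilizer (A × B) x).comap (MonoidHom.inr A B)

end Orbits

/-! ## Second cohomology with trivial coefficients -/

section Cohomology

variable (Q N : Type*) [Group Q] [CommGroup N]

/-- 2-cocycles of `Q` with values in the trivial `Q`-module `N` (written multiplicatively). -/
def trivZ2 : Subgroup (Q → Q → N) where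
  carrier := {f | ∀ a b c, f a b * f (a * b) c = f b c * f a (b * c)}
  one_mem' := by intro a b c; simp
  mul_mem' := by
    intro f g hf hg a b c
    simp only [Pi.mul_apply]
    rw [mul_mul_mul_comm, hf a b c, hg a b c, mul_mul_mul_comm]
  inv_mem' := by
    intro f hf a b c
    simp only [Pi.inv_apply]
    rw [← mul_inv, ← mul_inv, hf a b c]

/-- 2-coboundaries of `Q` with values in the trivial `Q`-module `N`. -/
def trivB2 : Subgroup (Q → Q → N) where
  carrier := {f | ∃ h : Q → N, ∀ a b, f a b = h a * h b * (h (a * b))⁻¹}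
  one_mem' := ⟨1, by intro a b; simp⟩
  mul_mem' := by
    rintro f g ⟨h, hf⟩ ⟨k, hg⟩
    refine ⟨h * k, fun a b => ?_⟩
    simp only [Pi.mul_apply, hf a b, hg a b, mul_inv]
    ac_rfl
  inv_mem' := by
    rintro f ⟨h, hf⟩
    refine ⟨h⁻¹, fun a b => ?_⟩
    simp only [Pi.inv_apply, hf a b, mul_inv]

/-- `H²(Q, N)` for the trivial `Q`-module `N`. -/
abbrev TrivH2 : Type _ := trivZ2 Q N ⧸ (trivB2 Q N).subgroupOf (trivZ2 Q N)

variable {Q N}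

/-- The automorphism of `Z²(Q, N)` given by a pair `(σ, τ)`: pull back along `σ⁻¹`, push forward
along `τ`. -/
def trivZ2Act (p : MulAut Q × MulAut N) : trivZ2 Q N →* trivZ2 Q N where
  toFun f := ⟨fun a b => p.2 (f.1 (p.1⁻¹ a) (p.1⁻¹ b)), by
    intro a b c
    simp only [map_mul]
    rw [← map_mul p.2, ← map_mul p.2, f.2 (p.1⁻¹ a) (p.1⁻¹ b) (p.1⁻¹ c)]⟩
  map_one' := by ext a b; simp
  map_mul' f g := by ext a b; simp

theorem trivB2_le_comap_trivZ2Act (p : MulAut Q × MulAut N) :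
    (trivB2 Q N).subgroupOf (trivZ2 Q N) ≤
      ((trivB2 Q N).subgroupOf (trivZ2 Q N)).comap (trivZ2Act p) := by
  rintro f ⟨h, hf⟩
  refine ⟨fun a => p.2 (h (p.1⁻¹ a)), fun a b => ?_⟩
  refine (congrArg p.2 (hf (p.1⁻¹ a) (p.1⁻¹ b))).trans ?_
  simp only [map_mul, map_inv]

/-- The left action of `Aut(Q) × Aut(N)` on `H²(Q, N)`, `(σ, τ)[f] = [τ ∘ f ∘ (σ⁻¹ × σ⁻¹)]`. If `E`
is a central extension `N → G → Q` with maps `i, π`, this is the action that sends the class of `E`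
to the class of the extension `N → G → Q` with maps `i ∘ τ⁻¹, σ ∘ π`. -/
instance trivH2MulAction : MulAction (MulAut Q × MulAut N) (TrivH2 Q N) where
  smul p := QuotientGroup.map _ _ (trivZ2Act p) (trivB2_le_comap_trivZ2Act p)
  one_smul x := by
    induction x using QuotientGroup.induction_on with
    | H f => rfl
  mul_smul p q x := by
    induction x using QuotientGroup.induction_on with
    | H f =>
      refine congrArg QuotientGroup.mk (Subtype.ext ?_)
      funext a b
      simp [trivZ2Act]

end Cohomology

/-! ## Central extensions: extension class and the homomorphism `ρ` -/

namespace GroupExtension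

variable {N G Q : Type*} [CommGroup N] [Group G] [Group Q] (E : GroupExtension N G Q)

theorem exists_factor (s : E.Section) (a b : Q) :
    ∃ n : N, E.inl n * s (a * b) = s a * s b := by
  have : s a * s b * (s (a * b))⁻¹ ∈ E.inl.range := by
    rw [E.range_inl_eq_ker_rightHom, MonoidHom.mem_ker]
    simp
  obtain ⟨n, hn⟩ := this
  exact ⟨n, by rw [hn]; group⟩

/-- The factor set of a set-theoretic section `s`: the function `f` with
`s a * s b = f(a, b) * s (a * b)`. -/
noncomputable def factorSet (s : E.Section) (a b : Q) : N := (E.exists_factor s a b).choose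

theorem inl_factorSet (s : E.Section) (a b : Q) :
    E.inl (E.factorSet s a b) * s (a * b) = s a * s b :=
  (E.exists_factor s a b).choose_spec

theorem factorSet_mem (hE : E.inl.range ≤ Subgroup.center G) (s : E.Section) :
    E.factorSet s ∈ trivZ2 Q N := by
  intro a b c
  apply E.inl_injective
  have hc : ∀ n g, E.inl n * g = g * E.inl n := fun n g =>
    (Subgroup.mem_center_iff.1 (hE ⟨n, rfl⟩) g).symm
  have h1 : E.inl (E.factorSet s a b * E.factorSet s (a * b) c) * s (a * b * c)
      = s a * s b * s c := by
    rw [map_mul, mul_assoc, inl_factorSet, ← mul_assoc, inl_factorSet]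
  have h2 : E.inl (E.factorSet s b c * E.factorSet s a (b * c)) * s (a * b * c)
      = s a * s b * s c := by
    rw [map_mul, mul_assoc a b c, mul_assoc, inl_factorSet, ← mul_assoc, hc, mul_assoc,
      inl_factorSet, mul_assoc]
  exact mul_right_cancel (h1.trans h2.symm)

/-- The extension class `[E] ∈ H²(Q, N)` of a central extension. -/
noncomputable def extClass (hE : E.inl.range ≤ Subgroup.center G) : TrivH2 Q N :=
  QuotientGroup.mk ⟨E.factorSet ⟨_, Function.rightInverse_surjInv E.rightHom_surjective⟩,
    E.factorSet_mem hE _⟩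

/-- The extension class can be computed with any section. -/
theorem extClass_eq (hE : E.inl.range ≤ Subgroup.center G) (s : E.Section) :
    E.extClass hE = QuotientGroup.mk ⟨E.factorSet s, E.factorSet_mem hE s⟩ := by
  set t : E.Section := ⟨_, Function.rightInverse_surjInv E.rightHom_surjective⟩ with ht
  have hc : ∀ n g, E.inl n * g = g * E.inl n := fun n g =>
    (Subgroup.mem_center_iff.1 (hE ⟨n, rfl⟩) g).symm
  have hd : ∀ a, ∃ n : N, E.inl n * t a = s a := by
    intro a
    have : s a * (t a)⁻¹ ∈ E.inl.range := by
      rw [E.range_inl_eq_ker_rightHom, MonoidHom.mem_ker]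
      simp
    obtain ⟨n, hn⟩ := this
    exact ⟨n, by rw [hn]; group⟩
  choose d hd using hd
  refine QuotientGroup.eq.2 ⟨d, fun a b => ?_⟩
  change (E.factorSet t a b)⁻¹ * E.factorSet s a b = _
  rw [inv_mul_eq_iff_eq_mul]
  have key : E.factorSet s a b * d (a * b) = E.factorSet t a b * (d a * d b) := by
    apply E.inl_injective
    apply mul_right_cancel (b := t (a * b))
    calc E.inl (E.factorSet s a b * d (a * b)) * t (a * b)
        = s a * s b := by rw [map_mul, mul_assoc, hd, inl_factorSet]
      _ = E.inl (d a) * (E.inl (d b) * (t a * t b)) := by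
        rw [← hd a, ← hd b, mul_assoc, ← mul_assoc (t a), ← hc (d b) (t a), mul_assoc]
      _ = E.inl (E.factorSet t a b * (d a * d b)) * t (a * b) := by
        rw [← E.inl_factorSet t, mul_comm (E.factorSet t a b), map_mul E.inl, map_mul E.inl,
          mul_assoc, mul_assoc]
  rw [← mul_assoc, ← key, mul_inv_cancel_right]

/-- The isotropy group `Aut(Q)_{[E]}` of the extension class. -/
noncomputable def isotropyQ (hE : E.inl.range ≤ Subgroup.center G) : Subgroup (MulAut Q) :=
  isotropyLeft (MulAut Q) (MulAut N) (E.extClass hE)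

/-- The isotropy group `Aut(N)_{[E]}` of the extension class. -/
noncomputable def isotropyN (hE : E.inl.range ≤ Subgroup.center G) : Subgroup (MulAut N) :=
  isotropyRight (MulAut Q) (MulAut N) (E.extClass hE)

/-- The intersection orbit `Ω([E])` of the extension class. -/
noncomputable def Omega (hE : E.inl.range ≤ Subgroup.center G) : Set (TrivH2 Q N) :=
  intersectionOrbit (MulAut Q) (MulAut N) (E.extClass hE)

/-- `Aut_N(G)`: the automorphisms of `G` that map `N` onto itself. -/
def autN : Subgroup (MulAut G) where
  carrier := {α | E.inl.range.map α.toMonoidHom = E.inl.range}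
  one_mem' := Subgroup.map_id _
  mul_mem' := by
    intro α β hα hβ
    change E.inl.range.map (α.toMonoidHom.comp β.toMonoidHom) = _
    rw [← Subgroup.map_map, hβ, hα]
  inv_mem' := by
    intro α hα
    change E.inl.range.map (α⁻¹ : MulAut G).toMonoidHom = _
    have hα' : E.inl.range.map α.toMonoidHom = E.inl.range := hα
    conv_lhs => rw [← hα', Subgroup.map_map]
    convert Subgroup.map_id _
    ext g
    exact α.symm_apply_apply g

theorem autN_mem_range (α : E.autN) (n : N) : α.1 (E.inl n) ∈ E.inl.range := by
  rw [← α.2]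
  exact ⟨E.inl n, ⟨n, rfl⟩, rfl⟩

/-- The restriction to `N` of an automorphism in `Aut_N(G)`, as an endomorphism. -/
noncomputable def restrictN (α : E.autN) (n : N) : N := (E.autN_mem_range α n).choose

theorem inl_restrictN (α : E.autN) (n : N) : E.inl (E.restrictN α n) = α.1 (E.inl n) :=
  (E.autN_mem_range α n).choose_spec

/-- The component `ρ_N : Aut_N(G) → Aut(N)`, restriction to `N`. -/
noncomputable def rhoN : E.autN →* MulAut N where
  toFun α :=
    { toFun := E.restrictN α
      invFun := E.restrictN α⁻¹
      left_inv := fun n => E.inl_injective (by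
        rw [inl_restrictN, inl_restrictN]; exact α.1.symm_apply_apply _)
      right_inv := fun n => E.inl_injective (by
        rw [inl_restrictN, inl_restrictN]; exact α.1.apply_symm_apply _)
      map_mul' := fun a b => E.inl_injective (by
        rw [inl_restrictN, map_mul, map_mul, map_mul, inl_restrictN, inl_restrictN]) }
  map_one' := by
    ext n
    exact E.inl_injective (E.inl_restrictN 1 n)
  map_mul' α β := by
    ext n
    apply E.inl_injective
    change E.inl (E.restrictN (α * β) n) = E.inl (E.restrictN α (E.restrictN β n))
    rw [inl_restrictN, inl_restrictN, inl_restrictN]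
    rfl

/-- The self-map of `Q` induced by an automorphism in `Aut_N(G)`. -/
noncomputable def inducedQ (α : E.autN) (q : Q) : Q :=
  E.rightHom (α.1 (Function.surjInv E.rightHom_surjective q))

theorem inducedQ_rightHom (α : E.autN) (g : G) :
    E.inducedQ α (E.rightHom g) = E.rightHom (α.1 g) := by
  have h : (Function.surjInv E.rightHom_surjective (E.rightHom g))⁻¹ * g ∈ E.inl.range := by
    rw [E.range_inl_eq_ker_rightHom, MonoidHom.mem_ker, map_mul, map_inv,
      Function.surjInv_eq E.rightHom_surjective, inv_mul_cancel]
  obtain ⟨n, hn⟩ := h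
  have h2 : E.rightHom (α.1 ((Function.surjInv E.rightHom_surjective (E.rightHom g))⁻¹ * g)) = 1 := by
    rw [← hn, ← inl_restrictN, rightHom_inl]
  rw [map_mul, map_inv, map_mul, map_inv, inv_mul_eq_one] at h2
  exact h2

/-- The component `ρ_Q : Aut_N(G) → Aut(Q)`, the induced automorphism of the quotient. -/
noncomputable def rhoQ : E.autN →* MulAut Q where
  toFun α :=
    { toFun := E.inducedQ α
      invFun := E.inducedQ α⁻¹
      left_inv := fun q => by
        obtain ⟨g, rfl⟩ := E.rightHom_surjective q
        rw [inducedQ_rightHom, inducedQ_rightHom]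
        exact congrArg E.rightHom (α.1.symm_apply_apply g)
      right_inv := fun q => by
        obtain ⟨g, rfl⟩ := E.rightHom_surjective q
        rw [inducedQ_rightHom, inducedQ_rightHom]
        exact congrArg E.rightHom (α.1.apply_symm_apply g)
      map_mul' := fun p q => by
        obtain ⟨g, rfl⟩ := E.rightHom_surjective p
        obtain ⟨h, rfl⟩ := E.rightHom_surjective q
        rw [← map_mul, inducedQ_rightHom, inducedQ_rightHom, inducedQ_rightHom, map_mul, map_mul] }
  map_one' := by
    ext q
    obtain ⟨g, rfl⟩ := E.rightHom_surjective q
    exact E.inducedQ_rightHom 1 g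
  map_mul' α β := by
    ext q
    obtain ⟨g, rfl⟩ := E.rightHom_surjective q
    change E.inducedQ (α * β) (E.rightHom g) = E.inducedQ α (E.inducedQ β (E.rightHom g))
    rw [inducedQ_rightHom, inducedQ_rightHom, inducedQ_rightHom]
    rfl

/-- The homomorphism `ρ = (ρ_Q, ρ_N) : Aut_N(G) → Aut(Q) × Aut(N)`. -/
noncomputable def rho : E.autN →* MulAut Q × MulAut N := E.rhoQ.prod E.rhoN

end GroupExtension

/-! ## Quadratic forms over the field with two elements -/

/-- The elementary abelian 2-group `F₂^d`, written multiplicatively. -/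
abbrev ElemAb (d : ℕ) : Type := Multiplicative (Fin d → ZMod 2)

/-- For a quadratic form `p = ∑_{i ≤ j} c_ij x_i x_j`, the 2-cocycle `(u, v) ↦ ∑_{i ≤ j} c_ij u_i v_j`
of `F₂^m` with values in `F₂`. The coordinate function `x_i` is a class in `H¹(F₂^m, F₂)` and
`(u, v) ↦ u_i v_j` is the cup product cocycle of `x_i` and `x_j`. So this cocycle represents the
degree 2 element `p` of `H^*(F₂^m, F₂) = F₂[x_1, …, x_m]`. -/
noncomputable def formCocycle {m : ℕ} (p : MvPolynomial (Fin m) (ZMod 2)) (u v : Fin m → ZMod 2) : ZMod 2 :=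
  ∑ i, ∑ j ∈ Finset.Ici i,
    p.coeff (Finsupp.single i 1 + Finsupp.single j 1) * (u i * v j)

theorem formCocycle_add_left {m : ℕ} (p : MvPolynomial (Fin m) (ZMod 2))
    (u u' v : Fin m → ZMod 2) :
    formCocycle p (u + u') v = formCocycle p u v + formCocycle p u' v := by
  simp [formCocycle, add_mul, mul_add, Finset.sum_add_distrib]

theorem formCocycle_add_right {m : ℕ} (p : MvPolynomial (Fin m) (ZMod 2))
    (u v v' : Fin m → ZMod 2) :
    formCocycle p u (v + v') = formCocycle p u v + formCocycle p u v' := by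
  simp [formCocycle, mul_add, Finset.sum_add_distrib]

/-- The class `(X_1, …, X_n) ∈ H²(F₂^m, F₂^n)` of an `n`-tuple of quadratic forms. -/
noncomputable def formClass {m n : ℕ} (X : Fin n → MvPolynomial (Fin m) (ZMod 2)) :
    TrivH2 (ElemAb m) (ElemAb n) :=
  QuotientGroup.mk ⟨fun u v => Multiplicative.ofAdd fun l =>
      formCocycle (X l) u.toAdd v.toAdd, by
    intro a b c
    apply Multiplicative.toAdd.injective
    funext l
    simp only [toAdd_mul, toAdd_ofAdd, Pi.add_apply, formCocycle_add_left, formCocycle_add_right]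
    ring⟩

/-- The standard form `x_1 x_2 + ⋯ + x_{m-1} x_m`, `m = 2 r`, of Arf invariant `+1`. -/
noncomputable def PhiPlus (r : ℕ) : MvPolynomial (Fin (2 * r)) (ZMod 2) :=
  ∑ i : Fin r, MvPolynomial.X ⟨2 * i, by omega⟩ * MvPolynomial.X ⟨2 * i + 1, by omega⟩

/-- The standard form `x_1 x_2 + ⋯ + x_{m-3} x_{m-2} + x_{m-1}² + x_{m-1} x_m + x_m²`, `m = 2 r`, of
Arf invariant `-1` (for `r ≥ 1`). -/
noncomputable def PhiMinus (r : ℕ) : MvPolynomial (Fin (2 * r)) (ZMod 2) :=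
  ∑ i : Fin r,
    (MvPolynomial.X ⟨2 * i, by omega⟩ * MvPolynomial.X ⟨2 * i + 1, by omega⟩ +
      if (i : ℕ) + 1 = r then
        MvPolynomial.X ⟨2 * i, by omega⟩ ^ 2 + MvPolynomial.X ⟨2 * i + 1, by omega⟩ ^ 2
      else 0)

/-- The group of invertible matrices over `F₂` that preserve the form `p`. -/
def formOrthogonalGroup {m : ℕ} (p : MvPolynomial (Fin m) (ZMod 2)) :
    Subgroup (GL (Fin m) (ZMod 2)) where
  carrier := {A | ∀ v : Fin m → ZMod 2,
    MvPolynomial.eval (A.val.mulVec v) p = MvPolynomial.eval v p}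
  one_mem' := by intro v; simp
  mul_mem' := by
    intro A B hA hB v
    rw [Units.val_mul, ← Matrix.mulVec_mulVec, hA, hB]
  inv_mem' := by
    intro A hA v
    rw [← hA, Matrix.mulVec_mulVec, ← Units.val_mul, mul_inv_cancel, Units.val_one,
      Matrix.one_mulVec]

/-- `O_{2r}^+(F₂)`. -/
noncomputable def OPlus (r : ℕ) : Subgroup (GL (Fin (2 * r)) (ZMod 2)) :=
  formOrthogonalGroup (PhiPlus r)

/-- `O_{2r}^-(F₂)`. -/
noncomputable def OMinus (r : ℕ) : Subgroup (GL (Fin (2 * r)) (ZMod 2)) :=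
  formOrthogonalGroup (PhiMinus r)

/-! ## Automorphisms of elementary abelian groups as matrices -/

/-- A matrix `A` as the automorphism `v ↦ A v` (column vectors). -/
def colAut (d : ℕ) : GL (Fin d) (ZMod 2) →* MulAut (ElemAb d) where
  toFun A :=
    { toFun := fun v => Multiplicative.ofAdd (A.val.mulVec v.toAdd)
      invFun := fun v => Multiplicative.ofAdd (A⁻¹.val.mulVec v.toAdd)
      left_inv := fun v => by
        beta_reduce
        rw [toAdd_ofAdd, Matrix.mulVec_mulVec, ← Units.val_mul, inv_mul_cancel, Units.val_one,
          Matrix.one_mulVec, ofAdd_toAdd]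
      right_inv := fun v => by
        beta_reduce
        rw [toAdd_ofAdd, Matrix.mulVec_mulVec, ← Units.val_mul, mul_inv_cancel, Units.val_one,
          Matrix.one_mulVec, ofAdd_toAdd]
      map_mul' := fun v w => by rw [toAdd_mul, Matrix.mulVec_add, ofAdd_add] }
  map_one' := by ext v : 1; exact congrArg Multiplicative.ofAdd (Matrix.one_mulVec _)
  map_mul' A B := by
    ext v : 1
    exact congrArg Multiplicative.ofAdd (Matrix.mulVec_mulVec _ A.val B.val).symm

/-- A matrix `T` as the automorphism `v ↦ v T⁻¹` (row vectors). With this identification of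
`GL_n(F₂)` and `Aut(N)`, `N = F₂^n`, a matrix `T` sends the `n`-tuple `[E] = (X_1, …, X_n)` to the
matrix product `[E] T⁻¹`. -/
def rowAut (d : ℕ) : GL (Fin d) (ZMod 2) →* MulAut (ElemAb d) where
  toFun T :=
    { toFun := fun v => Multiplicative.ofAdd (Matrix.vecMul v.toAdd T⁻¹.val)
      invFun := fun v => Multiplicative.ofAdd (Matrix.vecMul v.toAdd T.val)
      left_inv := fun v => by
        beta_reduce
        rw [toAdd_ofAdd, Matrix.vecMul_vecMul, ← Units.val_mul, inv_mul_cancel, Units.val_one,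
          Matrix.vecMul_one, ofAdd_toAdd]
      right_inv := fun v => by
        beta_reduce
        rw [toAdd_ofAdd, Matrix.vecMul_vecMul, ← Units.val_mul, mul_inv_cancel, Units.val_one,
          Matrix.vecMul_one, ofAdd_toAdd]
      map_mul' := fun v w => by rw [toAdd_mul, Matrix.add_vecMul, ofAdd_add] }
  map_one' := by
    ext v : 1
    change Multiplicative.ofAdd (Matrix.vecMul v.toAdd (1⁻¹ : GL (Fin d) (ZMod 2)).val) = v
    rw [inv_one, Units.val_one, Matrix.vecMul_one, ofAdd_toAdd]
  map_mul' S T := by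
    ext v : 1
    change Multiplicative.ofAdd (Matrix.vecMul v.toAdd (S * T)⁻¹.val) =
      Multiplicative.ofAdd (Matrix.vecMul (Matrix.vecMul v.toAdd T⁻¹.val) S⁻¹.val)
    rw [Matrix.vecMul_vecMul, mul_inv_rev, Units.val_mul]

theorem colAut_bijective (d : ℕ) : Function.Bijective (colAut d) := by
  constructor
  · intro A B h
    apply Units.ext
    apply Matrix.ext_of_mulVec_single
    intro i
    exact congrArg Multiplicative.toAdd (DFunLike.congr_fun h (Multiplicative.ofAdd (Pi.single i 1)))
  · intro σ
    let f : (Fin d → ZMod 2) ≃ₗ[ZMod 2] (Fin d → ZMod 2) :=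
      { (MulAutMultiplicative _ σ).toAdd with
        map_smul' := fun c v => ZMod.map_smul (MulAutMultiplicative _ σ).toAdd c v }
    refine ⟨Matrix.GeneralLinearGroup.toLin.symm
      ((LinearMap.GeneralLinearGroup.generalLinearEquiv _ _).symm f), ?_⟩
    ext v : 1
    have h := Matrix.GeneralLinearGroup.toLin_apply (Matrix.GeneralLinearGroup.toLin.symm
      ((LinearMap.GeneralLinearGroup.generalLinearEquiv _ _).symm f)) v.toAdd
    rw [MulEquiv.apply_symm_apply] at h
    exact congrArg Multiplicative.ofAdd h.symm

theorem rowAut_bijective (d : ℕ) : Function.Bijective (rowAut d) := by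
  constructor
  · intro S T h
    apply inv_injective
    apply Units.ext
    apply Matrix.ext_of_single_vecMul
    intro i
    exact congrArg Multiplicative.toAdd (DFunLike.congr_fun h (Multiplicative.ofAdd (Pi.single i 1)))
  · intro σ
    obtain ⟨A, rfl⟩ := (colAut_bijective d).2 σ
    have h1 : A.val.transpose * A⁻¹.val.transpose = 1 := by
      rw [← Matrix.transpose_mul, ← Units.val_mul, inv_mul_cancel, Units.val_one,
        Matrix.transpose_one]
    have h2 : A⁻¹.val.transpose * A.val.transpose = 1 := by
      rw [← Matrix.transpose_mul, ← Units.val_mul, mul_inv_cancel, Units.val_one,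
        Matrix.transpose_one]
    refine ⟨⟨A⁻¹.val.transpose, A.val.transpose, h2, h1⟩, ?_⟩
    ext v : 1
    exact congrArg Multiplicative.ofAdd (Matrix.vecMul_transpose A.val v.toAdd)

/-- The group of block matrices `(I_j 0; * GL_{n-j}(F₂))`: the invertible matrices whose first `j`
rows are those of the identity matrix. (The lower right block is then automatically invertible.) -/
def lowerParabolic (n j : ℕ) : Subgroup (GL (Fin n) (ZMod 2)) where
  carrier := {T | ∀ i : Fin n, (i : ℕ) < j → ∀ l, T.val i l = (1 : Matrix _ _ (ZMod 2)) i l}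
  one_mem' := by intro i _ l; rfl
  mul_mem' := by
    intro S T hS hT i hi l
    have : S.val i = (1 : Matrix _ _ (ZMod 2)) i := funext (hS i hi)
    rw [Units.val_mul, Matrix.mul_apply', this, ← Matrix.mul_apply', one_mul, hT i hi]
  inv_mem' := by
    intro T hT i hi l
    have : T.val i = (1 : Matrix _ _ (ZMod 2)) i := funext (hT i hi)
    have h : (T.val * T⁻¹.val) i l = (1 : Matrix _ _ (ZMod 2)) i l := by
      rw [← Units.val_mul, mul_inv_cancel, Units.val_one]
    rwa [Matrix.mul_apply', this, ← Matrix.mul_apply', one_mul] at h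

/-- Conjugacy of subgroups of a group. -/
def SubgroupConj {H : Type*} [Group H] (K L : Subgroup H) : Prop :=
  ∃ g : H, K.map (MulAut.conj g).toMonoidHom = L

/-! ## Automorphisms of central extensions and the extension class -/

namespace GroupExtension

variable {N G Q : Type*} [CommGroup N] [Group G] [Group Q] (E : GroupExtension N G Q)

/-! The argument removes the group theory first and is then quadratic form theory over `F₂`. A pair
`(σ, τ)` is induced by an automorphism of `G` exactly when it fixes `[E]` (`mem_range_rho_iff`). If
it does, then `σ[E] = τ⁻¹[E]` lies in `Ω([E])`. When `Ω([E])` is the single point `[E]`, both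
components fix `[E]`, so `Im ρ` is the product of the two isotropy groups (`card_range_rho`).

Cohomology is removed next. A biadditive cocycle of `F₂^m` is determined up to coboundary by its
diagonal, because an alternating bilinear map is the polarization of a function
(`trivH2_mk_eq_mk_iff`). Hence `[E]` becomes the quadratic map `v ↦ X(v) a + Y(v) b`, where `a` and
`b` are the indicator vectors of the two blocks of coordinates.

A point of `Ω([E])` comes from `σ, τ` that turn each of the forms `X`, `Y` occurring in `[E]` into a
combination `αX + βY`. The combination `0` is impossible since the forms are nonzero. The exchange
of `X` and `Y` is impossible since their numbers of zeros, `(4^r ± 2^r)/2`, differ. The sum `X + Y`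
is impossible because it is additive while `X` and `Y` have nondegenerate polar forms
(`PhiPlus_comp_eq`, `PhiMinus_comp_eq`). So `Ω([E])` is a point.

`Aut(V)_{[E]}` preserves the forms that occur, and `Aut(N)_{[E]}` fixes `a` and `b`, since the value
pairs `(X(v), Y(v))` span `F₂²`. Completing the nonzero ones among `a`, `b` to a basis gives the
block matrices. The orders of the orthogonal groups come from counting isometries: a hyperbolic pair
is chosen, and the rest maps to its complement, whose size and number of zeros are forced
(`four_mul_card_formMaps_hypSum`).

Whether `Im ρ` is a 2-group is a question about the prime 3. In the mixed case with `m ≥ 4` no order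
formula is needed: an explicit element of order 3 preserves both forms. -/

theorem trivH2_smul_mk (p : MulAut Q × MulAut N) (f : trivZ2 Q N) :
    p • (QuotientGroup.mk f : TrivH2 Q N) = QuotientGroup.mk (trivZ2Act p f) := rfl

theorem inl_mul_comm (hE : E.inl.range ≤ Subgroup.center G) (n : N) (g : G) :
    E.inl n * g = g * E.inl n :=
  (Subgroup.mem_center_iff.1 (hE ⟨n, rfl⟩) g).symm

theorem exists_inl_mul_section (s : E.Section) (g : G) :
    ∃ n : N, E.inl n * s (E.rightHom g) = g := by
  have : g * (s (E.rightHom g))⁻¹ ∈ E.inl.range := by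
    rw [E.range_inl_eq_ker_rightHom, MonoidHom.mem_ker]
    simp
  obtain ⟨n, hn⟩ := this
  exact ⟨n, by rw [hn]; group⟩

theorem rightHom_inl_mul_section (s : E.Section) (n : N) (q : Q) :
    E.rightHom (E.inl n * s q) = q := by
  simp

theorem inl_mul_section_injective (s : E.Section) {n n' : N} {q q' : Q}
    (h : E.inl n * s q = E.inl n' * s q') : n = n' ∧ q = q' := by
  have hq : q = q' := by
    rw [← E.rightHom_inl_mul_section s n q, h, E.rightHom_inl_mul_section]
  subst hq
  exact ⟨E.inl_injective (mul_right_cancel h), rfl⟩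

theorem inl_mul_section_mul (hE : E.inl.range ≤ Subgroup.center G) (s : E.Section)
    (n n' : N) (q q' : Q) :
    E.inl n * s q * (E.inl n' * s q') = E.inl (n * n' * E.factorSet s q q') * s (q * q') := by
  rw [map_mul, mul_assoc _ _ (s (q * q')), inl_factorSet, map_mul, mul_assoc (E.inl n),
    ← mul_assoc (s q), ← E.inl_mul_comm hE n' (s q)]
  simp only [mul_assoc]

/-- Two sections of a central extension and compatible automorphisms of the kernel and the quotient
give an automorphism of the extension. -/
theorem exists_autN_of_factorSet (hE : E.inl.range ≤ Subgroup.center G) (s t : E.Section)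
    (σ : MulAut Q) (τ : MulAut N)
    (h : ∀ a b, τ (E.factorSet s a b) = E.factorSet t (σ a) (σ b)) :
    ∃ α : E.autN, E.rho α = (σ, τ) := by
  -- Every `g` is uniquely `inl n * s q`, and `c g` is this `n`. The automorphism sought sends `inl
  -- n * s q` to `inl (τ n) * t (σ q)`.
  choose c hc using E.exists_inl_mul_section s
  have hcs : ∀ n q, c (E.inl n * s q) = n := fun n q =>
    (E.inl_mul_section_injective s (hc (E.inl n * s q))).1
  let φ : G →* G := MonoidHom.mk' (fun g => E.inl (τ (c g)) * t (σ (E.rightHom g))) (by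
    intro g g'
    have hm : c (g * g') = c g * c g' * E.factorSet s (E.rightHom g) (E.rightHom g') := by
      conv_lhs => rw [← hc g, ← hc g', E.inl_mul_section_mul hE, hcs]
    rw [E.inl_mul_section_mul hE, hm, map_mul τ, map_mul τ, h, map_mul E.rightHom, map_mul σ])
  have hφ : ∀ n q, φ (E.inl n * s q) = E.inl (τ n) * t (σ q) := fun n q => by
    change E.inl (τ (c _)) * t (σ (E.rightHom _)) = _
    rw [hcs, E.rightHom_inl_mul_section]
  have hφQ : ∀ g, E.rightHom (φ g) = σ (E.rightHom g) := fun g =>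
    E.rightHom_inl_mul_section t _ _
  have hφN : ∀ n, φ (E.inl n) = E.inl (τ n) := fun n => by
    -- The section is not normalized: `s 1` need not be `1`. So `inl n` is written as a quotient of
    -- two elements in normal form.
    have h1 : E.inl n = E.inl n * s 1 * (E.inl 1 * s 1)⁻¹ := by simp
    rw [h1, map_mul, map_inv, hφ, hφ]
    simp
  have hbij : Function.Bijective φ := by
    constructor
    · intro g g' hg
      obtain ⟨h1, h2⟩ := E.inl_mul_section_injective t hg
      rw [← hc g, ← hc g', τ.injective h1, σ.injective h2]
    · intro g
      obtain ⟨n, hn⟩ := E.exists_inl_mul_section t g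
      refine ⟨E.inl (τ.symm n) * s (σ.symm (E.rightHom g)), ?_⟩
      rw [hφ, τ.apply_symm_apply, σ.apply_symm_apply, hn]
  let α : MulAut G := MulEquiv.ofBijective φ hbij
  have hα : α ∈ E.autN := by
    change E.inl.range.map φ = E.inl.range
    ext g
    constructor
    · rintro ⟨_, ⟨n, rfl⟩, rfl⟩
      exact ⟨τ n, (hφN n).symm⟩
    · rintro ⟨n, rfl⟩
      exact ⟨E.inl (τ.symm n), ⟨_, rfl⟩, by rw [hφN, τ.apply_symm_apply]⟩
  refine ⟨⟨α, hα⟩, Prod.ext ?_ ?_⟩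
  · ext q
    obtain ⟨g, rfl⟩ := E.rightHom_surjective q
    exact (E.inducedQ_rightHom ⟨α, hα⟩ g).trans (hφQ g)
  · ext n
    exact E.inl_injective ((E.inl_restrictN ⟨α, hα⟩ n).trans (hφN n))

/-- The pairs of automorphisms induced by automorphisms of a central extension are those that fix
the extension class. -/
theorem mem_range_rho_iff (hE : E.inl.range ≤ Subgroup.center G) (p : MulAut Q × MulAut N) :
    p ∈ E.rho.range ↔ p • E.extClass hE = E.extClass hE := by
  let s : E.Section := ⟨_, Function.rightInverse_surjInv E.rightHom_surjective⟩
  have hs : ∀ t : E.Section, ∀ a b, E.inl (E.factorSet t a b) * t (a * b) = t a * t b :=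
    fun t => E.inl_factorSet t
  constructor
  · rintro ⟨α, rfl⟩
    have hQ : ∀ g, (E.rho α).1 (E.rightHom g) = E.rightHom (α.1 g) := E.inducedQ_rightHom α
    have hN : ∀ n, E.inl ((E.rho α).2 n) = α.1 (E.inl n) := E.inl_restrictN α
    -- Transport of `s` along the automorphism. The factor set of `t` is exactly the transformed
    -- factor set of `s`, and the class does not depend on the section.
    let t : E.Section := ⟨fun q => α.1 (s ((E.rho α).1⁻¹ q)), fun q => by
      rw [← hQ]
      have : E.rightHom (s ((E.rho α).1⁻¹ q)) = (E.rho α).1⁻¹ q := by simp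
      rw [this]
      exact (E.rho α).1.apply_symm_apply q⟩
    have ht : ∀ q, t q = α.1 (s ((E.rho α).1⁻¹ q)) := fun _ => rfl
    rw [E.extClass_eq hE s, trivH2_smul_mk]
    rw [← E.extClass_eq hE s, E.extClass_eq hE t]
    refine congrArg QuotientGroup.mk (Subtype.ext ?_)
    funext a b
    apply E.inl_injective
    apply mul_right_cancel (b := t (a * b))
    rw [hs t]
    change E.inl ((E.rho α).2 (E.factorSet s _ _)) * _ = _
    rw [hN, ht, ht, ht, map_mul, ← map_mul α.1, hs s, map_mul α.1]
  · intro h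
    rw [E.extClass_eq hE s, trivH2_smul_mk] at h
    obtain ⟨d, hd⟩ := QuotientGroup.eq.1 h.symm
    have hd' : ∀ a b, p.2 (E.factorSet s (p.1⁻¹ a) (p.1⁻¹ b)) =
        E.factorSet s a b * (d a * d b * (d (a * b))⁻¹) := fun a b => by
      rw [← hd a b]
      exact (mul_inv_cancel_left (E.factorSet s a b) _).symm
    -- The cochain `d` whose coboundary is the difference of the two cocycles corrects `s` to a
    -- section with the transformed factor set.
    let t : E.Section := ⟨fun q => E.inl (d q) * s q, fun q => by simp⟩
    have ht : ∀ q, t q = E.inl (d q) * s q := fun _ => rfl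
    have hst : ∀ a b, p.2 (E.factorSet s a b) = E.factorSet t (p.1 a) (p.1 b) := by
      intro a b
      have h1 := hd' (p.1 a) (p.1 b)
      rw [MulAut.inv_apply_self, MulAut.inv_apply_self] at h1
      rw [h1]
      apply E.inl_injective
      apply mul_right_cancel (b := t (p.1 a * p.1 b))
      rw [hs t, ht, ht, ht, E.inl_mul_section_mul hE, ← mul_assoc (E.inl _), ← map_mul]
      congr 2
      rw [mul_assoc, inv_mul_cancel_right, mul_comm]
    obtain ⟨α, hα⟩ := E.exists_autN_of_factorSet hE s t p.1 p.2 hst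
    exact ⟨α, hα⟩

/-- A pair that fixes the class satisfies `σ[E] = τ⁻¹[E]`, a point of the intersection orbit. If
that orbit is trivial, `σ` and `τ` fix the class separately, and the image of `ρ` is a full direct
product. -/
theorem card_range_rho (hE : E.inl.range ≤ Subgroup.center G)
    (hΩ : E.Omega hE = {E.extClass hE}) :
    Nat.card E.rho.range = Nat.card (E.isotropyQ hE) * Nat.card (E.isotropyN hE) := by
  have : E.rho.range = (E.isotropyQ hE).prod (E.isotropyN hE) := by
    ext ⟨σ, τ⟩
    rw [E.mem_range_rho_iff hE, Subgroup.mem_prod]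
    have hmul : ((σ, τ) : MulAut Q × MulAut N) = (1, τ) * (σ, 1) := by simp
    constructor
    · intro h
      have h1 : ((σ, 1) : MulAut Q × MulAut N) • E.extClass hE ∈ E.Omega hE := by
        refine ⟨⟨σ, rfl⟩, τ⁻¹, ?_⟩
        rw [hmul, mul_smul, ← eq_inv_smul_iff] at h
        rw [h]
        simp
      have h2 : ((σ, 1) : MulAut Q × MulAut N) • E.extClass hE = E.extClass hE := by
        rwa [hΩ] at h1
      refine ⟨h2, ?_⟩
      rw [hmul, mul_smul, h2] at h
      exact h
    · rintro ⟨h1, h2⟩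
      change ((σ, 1) : MulAut Q × MulAut N) • E.extClass hE = E.extClass hE at h1
      change ((1, τ) : MulAut Q × MulAut N) • E.extClass hE = E.extClass hE at h2
      rw [hmul, mul_smul, h1, h2]
  rw [this, Nat.card_congr (Subgroup.prodEquiv _ _).toEquiv, Nat.card_prod]

end GroupExtension

/-! ## Biadditive cocycles of elementary abelian 2-groups -/

theorem zmod_two_eq_zero_or_one (a : ZMod 2) : a = 0 ∨ a = 1 := by
  revert a; decide

theorem zmod_two_add_self {ι : Type*} (a : ι → ZMod 2) : a + a = 0 := by
  funext i; exact CharTwo.add_self_eq_zero (a i)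

/-- An alternating bilinear map over `F₂` is the polarization of a function. -/
theorem exists_polarization_of_alternating {m n : ℕ}
    (D : (Fin m → ZMod 2) →+ (Fin m → ZMod 2) →+ (Fin n → ZMod 2)) (hD : ∀ v, D v v = 0) :
    ∃ h : (Fin m → ZMod 2) → (Fin n → ZMod 2), ∀ a b, D a b = h a + h b + h (a + b) := by
  let c : Fin m → Fin m → Fin n → ZMod 2 := fun i j => D (Pi.single i 1) (Pi.single j 1)
  have hsingle : ∀ v : Fin m → ZMod 2, v = ∑ i, v i • (Pi.single i 1 : Fin m → ZMod 2) := by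
    intro v
    funext j
    simp [Finset.sum_apply, Pi.single_apply]
  have hexp : ∀ a b l, D a b l = ∑ i, ∑ j, a i * b j * c i j l := by
    intro a b l
    have h1 : D a b = ∑ i, a i • D (Pi.single i 1) b := by
      conv_lhs => rw [hsingle a]
      rw [map_sum, AddMonoidHom.finsetSum_apply]
      refine Finset.sum_congr rfl fun i _ => ?_
      rw [ZMod.map_smul D]
      exact ZMod.map_smul (AddMonoidHom.eval b) (a i) (D (Pi.single i 1))
    have h2 : ∀ i, D (Pi.single i 1) b = ∑ j, b j • c i j := by
      intro i
      conv_lhs => rw [hsingle b]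
      rw [map_sum]
      exact Finset.sum_congr rfl fun j _ => ZMod.map_smul _ _ _
    rw [h1, Finset.sum_apply]
    refine Finset.sum_congr rfl fun i _ => ?_
    rw [Pi.smul_apply, h2, Finset.sum_apply, Finset.smul_sum]
    refine Finset.sum_congr rfl fun j _ => ?_
    simp [mul_assoc]
  have hdiag : ∀ i, c i i = 0 := fun i => hD _
  have hsymm : ∀ i j, c i j = c j i := by
    intro i j
    have h1 := hD (Pi.single i 1 + Pi.single j 1)
    rw [map_add, map_add, AddMonoidHom.add_apply, AddMonoidHom.add_apply, hD, hD, zero_add,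
      add_zero] at h1
    have h2 : c j i + c i j = 0 := h1
    have h3 := zmod_two_add_self (c j i)
    exact add_left_cancel (h2.trans h3.symm)
  -- The matrix of `D` is symmetric with zero diagonal. Its strictly upper triangular part gives a
  -- quadratic map whose polarization is `D`.
  refine ⟨fun a l => ∑ i, ∑ j, if i < j then a i * a j * c i j l else 0, fun a b => ?_⟩
  funext l
  have hswap : ∑ i, ∑ j, (if i < j then b i * a j * c i j l else 0) =
      ∑ i, ∑ j, if j < i then a i * b j * c i j l else 0 := by
    rw [Finset.sum_comm]
    refine Finset.sum_congr rfl fun i _ => Finset.sum_congr rfl fun j _ => ?_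
    rw [hsymm j i, mul_comm (b j)]
  have hsplit : D a b l = ∑ i, ∑ j, (if i < j then a i * b j * c i j l else 0) +
      ∑ i, ∑ j, (if i < j then b i * a j * c i j l else 0) := by
    rw [hswap, hexp]
    simp only [← Finset.sum_add_distrib]
    refine Finset.sum_congr rfl fun i _ => Finset.sum_congr rfl fun j _ => ?_
    rcases lt_trichotomy i j with h | rfl | h
    · simp [h, h.le.not_gt]
    · simp [hdiag]
    · simp [h, h.le.not_gt]
  rw [hsplit]
  simp only [Pi.add_apply, ← Finset.sum_add_distrib]
  refine Finset.sum_congr rfl fun i _ => Finset.sum_congr rfl fun j _ => ?_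
  split_ifs
  · have h2 : (2 : ZMod 2) = 0 := rfl
    linear_combination (-(a i * a j * c i j l) - b i * b j * c i j l) * h2
  · simp

/-- Two biadditive 2-cocycles of `F₂^m` are cohomologous if and only if they have the same
restriction to the diagonal. -/
theorem trivH2_mk_eq_mk_iff {m n : ℕ} (f g : trivZ2 (ElemAb m) (ElemAb n))
    (hf₁ : ∀ a a' b, f.1 (a * a') b = f.1 a b * f.1 a' b)
    (hf₂ : ∀ a b b', f.1 a (b * b') = f.1 a b * f.1 a b')
    (hg₁ : ∀ a a' b, g.1 (a * a') b = g.1 a b * g.1 a' b)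
    (hg₂ : ∀ a b b', g.1 a (b * b') = g.1 a b * g.1 a b') :
    (QuotientGroup.mk f : TrivH2 (ElemAb m) (ElemAb n)) = QuotientGroup.mk g ↔
      ∀ v, f.1 v v = g.1 v v := by
  have hsq : ∀ {d : ℕ} (a : ElemAb d), a * a = 1 := fun a => zmod_two_add_self a.toAdd
  have hinv : ∀ {d : ℕ} (a : ElemAb d), a⁻¹ = a := fun a => inv_eq_of_mul_eq_one_left (hsq a)
  have hone : ∀ u : trivZ2 (ElemAb m) (ElemAb n),
      (∀ a a' b, u.1 (a * a') b = u.1 a b * u.1 a' b) → u.1 1 1 = 1 := by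
    intro u hu
    have := hu 1 1 1
    rw [one_mul] at this
    exact this.trans (hsq _)
  rw [QuotientGroup.eq]
  constructor
  · rintro ⟨h, hh⟩ v
    have hh' : ∀ a b, (f.1 a b)⁻¹ * g.1 a b = h a * h b * (h (a * b))⁻¹ := hh
    -- At `(1, 1)` the relation forces `h 1 = 1`. At `(v, v)` both `h v * h v` and `v * v` are
    -- trivial, so a coboundary vanishes on the diagonal.
    have h1 := hh' 1 1
    rw [hone f hf₁, hone g hg₁, one_mul, mul_inv_cancel_right, inv_one, one_mul] at h1
    have h2 := hh' v v
    rw [hsq, hsq, ← h1, inv_one, one_mul, inv_mul_eq_one] at h2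
    exact h2
  · intro h
    -- The difference of the cocycles, written as a sum in characteristic 2. Equal diagonals make it
    -- alternating.
    let D : (Fin m → ZMod 2) →+ (Fin m → ZMod 2) →+ (Fin n → ZMod 2) :=
      AddMonoidHom.mk' (fun a => AddMonoidHom.mk' (fun b => Multiplicative.toAdd
        (f.1 (Multiplicative.ofAdd a) (Multiplicative.ofAdd b) *
          g.1 (Multiplicative.ofAdd a) (Multiplicative.ofAdd b))) (by
            intro b b'
            rw [ofAdd_add, hf₂, hg₂, mul_mul_mul_comm, toAdd_mul])) (by
        intro a a'
        refine AddMonoidHom.ext fun b => ?_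
        change Multiplicative.toAdd (f.1 (Multiplicative.ofAdd (a + a')) _ *
          g.1 (Multiplicative.ofAdd (a + a')) _) = _
        rw [ofAdd_add, hf₁, hg₁, mul_mul_mul_comm, toAdd_mul]
        rfl)
    obtain ⟨k, hk⟩ := exists_polarization_of_alternating D (fun v => by
      change Multiplicative.toAdd (f.1 (Multiplicative.ofAdd v) (Multiplicative.ofAdd v) *
          g.1 (Multiplicative.ofAdd v) (Multiplicative.ofAdd v)) = _
      rw [h, hsq, toAdd_one])
    refine ⟨fun a => Multiplicative.ofAdd (k a.toAdd), fun a b => ?_⟩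
    change (f.1 a b)⁻¹ * g.1 a b = _
    rw [hinv, hinv]
    exact congrArg Multiplicative.ofAdd (hk a.toAdd b.toAdd)

/-! ### From cohomology classes to quadratic maps -/

/-- The cocycle of `formClass`. -/
noncomputable def formZ2 {m n : ℕ} (X : Fin n → MvPolynomial (Fin m) (ZMod 2)) :
    trivZ2 (ElemAb m) (ElemAb n) :=
  ⟨fun u v => Multiplicative.ofAdd fun l => formCocycle (X l) u.toAdd v.toAdd, by
    intro a b c
    apply Multiplicative.toAdd.injective
    funext l
    simp only [toAdd_mul, toAdd_ofAdd, Pi.add_apply, formCocycle_add_left, formCocycle_add_right]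
    ring⟩

theorem formClass_eq_mk {m n : ℕ} (X : Fin n → MvPolynomial (Fin m) (ZMod 2)) :
    formClass X = QuotientGroup.mk (formZ2 X) := rfl

/-- The diagonal of the cocycle of an `n`-tuple of forms. -/
noncomputable def formDiag {m n : ℕ} (X : Fin n → MvPolynomial (Fin m) (ZMod 2)) (v : ElemAb m) :
    ElemAb n :=
  Multiplicative.ofAdd fun l => formCocycle (X l) v.toAdd v.toAdd

/-- Automorphisms of source and target keep a cocycle biadditive, so only the diagonals need
comparing. After this point classes are replaced by quadratic maps. -/
theorem smul_formClass_eq_smul_iff {m n : ℕ} (X : Fin n → MvPolynomial (Fin m) (ZMod 2))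
    (p p' : MulAut (ElemAb m) × MulAut (ElemAb n)) :
    p • formClass X = p' • formClass X ↔
      ∀ v, p.2 (formDiag X (p.1⁻¹ v)) = p'.2 (formDiag X (p'.1⁻¹ v)) := by
  have h₁ : ∀ a a' b, (formZ2 X).1 (a * a') b = (formZ2 X).1 a b * (formZ2 X).1 a' b := by
    intro a a' b
    exact congrArg Multiplicative.ofAdd (funext fun l => formCocycle_add_left (X l) _ _ _)
  have h₂ : ∀ a b b', (formZ2 X).1 a (b * b') = (formZ2 X).1 a b * (formZ2 X).1 a b' := by
    intro a b b'
    exact congrArg Multiplicative.ofAdd (funext fun l => formCocycle_add_right (X l) _ _ _)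
  have ha₁ : ∀ (p : MulAut (ElemAb m) × MulAut (ElemAb n)) (a a' b),
      (trivZ2Act p (formZ2 X)).1 (a * a') b =
        (trivZ2Act p (formZ2 X)).1 a b * (trivZ2Act p (formZ2 X)).1 a' b := by
    intro p a a' b
    change p.2 ((formZ2 X).1 _ _) = p.2 ((formZ2 X).1 _ _) * p.2 ((formZ2 X).1 _ _)
    rw [map_mul, h₁, map_mul]
  have ha₂ : ∀ (p : MulAut (ElemAb m) × MulAut (ElemAb n)) (a b b'),
      (trivZ2Act p (formZ2 X)).1 a (b * b') =
        (trivZ2Act p (formZ2 X)).1 a b * (trivZ2Act p (formZ2 X)).1 a b' := by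
    intro p a b b'
    change p.2 ((formZ2 X).1 _ _) = p.2 ((formZ2 X).1 _ _) * p.2 ((formZ2 X).1 _ _)
    rw [map_mul, h₂, map_mul]
  rw [formClass_eq_mk, GroupExtension.trivH2_smul_mk, GroupExtension.trivH2_smul_mk]
  exact trivH2_mk_eq_mk_iff _ _ (ha₁ p) (ha₂ p) (ha₁ p') (ha₂ p')

/-! ## Counting isometries of nondegenerate quadratic forms over `F₂` -/

section Quadratic

variable {V V' : Type*} [AddCommGroup V] [Module (ZMod 2) V] [AddCommGroup V'] [Module (ZMod 2) V']

/-- `q` is a quadratic form over `F₂` with nondegenerate polar form `B`. -/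
structure IsNondegQuad (q : V → ZMod 2) (B : LinearMap.BilinForm (ZMod 2) V) : Prop where
  map_add : ∀ x y, q (x + y) = q x + q y + B x y
  nondeg : ∀ x, (∀ y, B x y = 0) → x = 0

/-- The linear maps that carry `q'` to `q`. -/
abbrev FormMaps (q' : V' → ZMod 2) (q : V → ZMod 2) : Type _ :=
  {f : V' →ₗ[ZMod 2] V // ∀ x, q (f x) = q' x}

/-- The orthogonal sum of a hyperbolic plane and `q'`. -/
def hypSum (q' : V' → ZMod 2) (x : (ZMod 2 × ZMod 2) × V') : ZMod 2 := x.1.1 * x.1.2 + q' x.2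

/-- The pairs of singular vectors `u, w` with `B u w = 1`. -/
def IsHypPair (q : V → ZMod 2) (B : LinearMap.BilinForm (ZMod 2) V) (p : V × V) : Prop :=
  q p.1 = 0 ∧ q p.2 = 0 ∧ B p.1 p.2 = 1

/-- The orthogonal complement of a pair of vectors. -/
def pairPerp (B : LinearMap.BilinForm (ZMod 2) V) (p : V × V) : Submodule (ZMod 2) V :=
  LinearMap.ker (B p.1) ⊓ LinearMap.ker (B p.2)

theorem mem_pairPerp {B : LinearMap.BilinForm (ZMod 2) V} {p : V × V} {x : V} :
    x ∈ pairPerp B p ↔ B p.1 x = 0 ∧ B p.2 x = 0 := by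
  simp [pairPerp]

theorem zmod_two_module_add_self (x : V) : x + x = 0 := by
  rw [← two_smul (ZMod 2) x, show (2 : ZMod 2) = 0 from rfl, zero_smul]

theorem sigma_formMaps_ext {q : V → ZMod 2} {B : LinearMap.BilinForm (ZMod 2) V}
    {q' : V' → ZMod 2}
    {x y : Σ p : {p : V × V // IsHypPair q B p}, FormMaps q' (fun y : pairPerp B p.1 => q y)}
    (h : x.1.1 = y.1.1) (h' : ∀ v, (x.2.1 v : V) = y.2.1 v) : x = y := by
  obtain ⟨⟨p, hp⟩, f, hf⟩ := x
  obtain ⟨⟨p', hp'⟩, f', hf'⟩ := y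
  obtain rfl : p = p' := h
  obtain rfl : f = f' := LinearMap.ext fun v => Subtype.ext (h' v)
  rfl

namespace IsNondegQuad

variable {q : V → ZMod 2} {B : LinearMap.BilinForm (ZMod 2) V} (h : IsNondegQuad q B)
include h

theorem map_zero : q 0 = 0 := by
  have := h.map_add 0 0
  simpa using this

theorem map_smul (a : ZMod 2) (x : V) : q (a • x) = a * q x := by
  rcases zmod_two_eq_zero_or_one a with rfl | rfl
  · simp [h.map_zero]
  · simp

theorem bilin_self (x : V) : B x x = 0 := by
  have := h.map_add x x
  rw [zmod_two_module_add_self, h.map_zero, CharTwo.add_self_eq_zero, zero_add] at this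
  exact this.symm

theorem bilin_comm (x y : V) : B x y = B y x := by
  have h1 := h.map_add x y
  rw [add_comm x y, h.map_add y x, add_comm (q y)] at h1
  exact (add_left_cancel h1).symm

theorem polar_eq (x y : V) : B x y = q (x + y) + q x + q y := by
  have h2 : (2 : ZMod 2) = 0 := rfl
  rw [h.map_add]
  linear_combination (-(q x) - q y) * h2

theorem exists_eq_one {x : V} (hx : x ≠ 0) : ∃ y, B x y = 1 := by
  by_contra hc
  refine hx (h.nondeg x fun y => ?_)
  rcases zmod_two_eq_zero_or_one (B x y) with h0 | h1
  · exact h0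
  · exact absurd ⟨y, h1⟩ hc

theorem polar_formMap {q' : V' → ZMod 2} (f : V' →ₗ[ZMod 2] V) (hf : ∀ x, q (f x) = q' x)
    (x y : V') : B (f x) (f y) = q' (x + y) + q' x + q' y := by
  rw [h.polar_eq, ← _root_.map_add, hf, hf, hf]

/-- A linear self-map that preserves a nondegenerate form is injective. -/
theorem formMap_injective (f : V →ₗ[ZMod 2] V) (hf : ∀ x, q (f x) = q x) :
    Function.Injective f := by
  rw [injective_iff_map_eq_zero]
  intro x hx
  refine h.nondeg x fun y => ?_
  rw [h.polar_eq, ← h.polar_formMap f hf, hx, _root_.map_zero, LinearMap.zero_apply]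

theorem bilin_hypPair {p : V × V} (hp : IsHypPair q B p) (a b : ZMod 2) (x : pairPerp B p) :
    B p.1 (a • p.1 + b • p.2 + x) = b ∧ B p.2 (a • p.1 + b • p.2 + x) = a := by
  obtain ⟨h1, h2⟩ := mem_pairPerp.1 x.2
  have h3 := hp.2.2
  have h4 : B p.2 p.1 = 1 := by rw [h.bilin_comm, h3]
  simp [h1, h2, h3, h4, h.bilin_self]

theorem map_hypPair_add {p : V × V} (hp : IsHypPair q B p) (a b : ZMod 2) (x : pairPerp B p) :
    q (a • p.1 + b • p.2 + x) = a * b + q x := by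
  obtain ⟨h1, h2⟩ := mem_pairPerp.1 x.2
  rw [h.map_add, h.map_add, h.map_smul, h.map_smul, hp.1, hp.2.1]
  simp [h1, h2, hp.2.2, mul_comm b]

/-- The splitting of `V` defined by a hyperbolic pair. -/
noncomputable def splitEquiv {p : V × V} (hp : IsHypPair q B p) :
    (ZMod 2 × ZMod 2) × pairPerp B p ≃ V where
  toFun x := x.1.1 • p.1 + x.1.2 • p.2 + x.2
  -- Since `B u w = 1` and `B` is alternating, the coefficient of `u` is read off by pairing with
  -- `w`, and conversely. Subtraction is addition in characteristic 2.
  invFun v := ((B p.2 v, B p.1 v), ⟨v + B p.2 v • p.1 + B p.1 v • p.2, by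
    have h3 := hp.2.2
    have h4 : B p.2 p.1 = 1 := by rw [h.bilin_comm, h3]
    rw [mem_pairPerp]
    simp [h3, h4, h.bilin_self, CharTwo.add_self_eq_zero]⟩)
  left_inv := by
    rintro ⟨⟨a, b⟩, x⟩
    obtain ⟨h1, h2⟩ := h.bilin_hypPair hp a b x
    refine Prod.ext (Prod.ext h2 h1) (Subtype.ext ?_)
    dsimp only
    rw [h1, h2]
    have e1 := zmod_two_module_add_self (a • p.1)
    have e2 := zmod_two_module_add_self (b • p.2)
    calc a • p.1 + b • p.2 + (x : V) + a • p.1 + b • p.2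
        = x + (a • p.1 + a • p.1) + (b • p.2 + b • p.2) := by abel
      _ = x := by rw [e1, e2, add_zero, add_zero]
  right_inv := by
    intro v
    have e1 := zmod_two_module_add_self (B p.2 v • p.1)
    have e2 := zmod_two_module_add_self (B p.1 v • p.2)
    calc B p.2 v • p.1 + B p.1 v • p.2 + (v + B p.2 v • p.1 + B p.1 v • p.2)
        = v + (B p.2 v • p.1 + B p.2 v • p.1) + (B p.1 v • p.2 + B p.1 v • p.2) := by abel
      _ = v := by rw [e1, e2, add_zero, add_zero]

theorem map_splitEquiv {p : V × V} (hp : IsHypPair q B p) (x) :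
    q (h.splitEquiv hp x) = hypSum (fun y : pairPerp B p => q y) x :=
  h.map_hypPair_add hp _ _ _

/-- By the splitting, a vector of the complement that is orthogonal to the complement is orthogonal
to the whole space. -/
theorem perp {p : V × V} (hp : IsHypPair q B p) :
    IsNondegQuad (fun y : pairPerp B p => q y) (B.restrict (pairPerp B p)) where
  map_add x y := h.map_add x y
  nondeg x hx := by
    refine Subtype.ext (h.nondeg x fun y => ?_)
    obtain ⟨⟨⟨a, b⟩, z⟩, rfl⟩ := (h.splitEquiv hp).surjective y
    obtain ⟨h1, h2⟩ := mem_pairPerp.1 x.2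
    have h3 : B x z = 0 := hx z
    rw [h.bilin_comm] at h1 h2
    change B x (a • p.1 + b • p.2 + z) = 0
    simp [h1, h2, h3]

/-- A form-preserving map from the orthogonal sum of a hyperbolic plane and `q'` consists of a
hyperbolic pair and a form-preserving map from `q'` to the complement. -/
noncomputable def formMapsEquiv (q' : V' → ZMod 2) :
    FormMaps (hypSum q') q ≃ Σ p : {p : V × V // IsHypPair q B p},
      FormMaps q' (fun y : pairPerp B p.1 => q y) where
  toFun f :=
    -- No quadratic law is assumed for `q'`; its value at zero is inherited from `q` through `f`.
    have hq' : q' 0 = 0 := by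
      have := f.2 0
      rw [_root_.map_zero, h.map_zero] at this
      simpa [hypSum] using this.symm
    have hp : IsHypPair q B (f.1 ((1, 0), 0), f.1 ((0, 1), 0)) := by
      refine ⟨?_, ?_, ?_⟩
      · rw [f.2]; simp [hypSum, hq']
      · rw [f.2]; simp [hypSum, hq']
      · dsimp only
        rw [h.polar_formMap f.1 f.2]; simp [hypSum, hq']
    ⟨⟨_, hp⟩, ⟨LinearMap.codRestrict _ (f.1 ∘ₗ LinearMap.inr _ _ _) (by
      intro x
      rw [mem_pairPerp]
      constructor
      · refine (h.polar_formMap f.1 f.2 _ _).trans ?_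
        simp [hypSum, hq', CharTwo.add_self_eq_zero]
      · refine (h.polar_formMap f.1 f.2 _ _).trans ?_
        simp [hypSum, hq', CharTwo.add_self_eq_zero]), by
      intro x
      refine (f.2 _).trans ?_
      simp [hypSum]⟩⟩
  invFun g := ⟨LinearMap.coprod (LinearMap.coprod (LinearMap.toSpanSingleton _ _ g.1.1.1)
      (LinearMap.toSpanSingleton _ _ g.1.1.2)) ((pairPerp B g.1.1).subtype ∘ₗ g.2.1), by
    rintro ⟨⟨a, b⟩, x⟩
    have := h.map_hypPair_add g.1.2 a b (g.2.1 x)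
    exact this.trans (congrArg (a * b + ·) (g.2.2 x))⟩
  left_inv f := by
    apply Subtype.ext
    refine LinearMap.ext fun x => ?_
    obtain ⟨⟨a, b⟩, x⟩ := x
    change a • f.1 ((1, 0), 0) + b • f.1 ((0, 1), 0) + f.1 (0, x) = _
    rw [← _root_.map_smul, ← _root_.map_smul, ← _root_.map_add, ← _root_.map_add]
    congr 1
    simp
  right_inv g := by
    obtain ⟨⟨⟨u, w⟩, hp⟩, g, hg⟩ := g
    refine sigma_formMaps_ext ?_ fun x => ?_
    · ext <;> simp
    · change (0 : ZMod 2) • u + (0 : ZMod 2) • w + (g x : V) = g x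
      simp

/-- The vectors `w` that form a hyperbolic pair with a given singular vector. -/
noncomputable def hypPairEquiv {u w₀ : V} (hu : q u = 0) (hw₀ : B u w₀ = 1) :
    (ZMod 2 × ZMod 2) × {w : V // q w = 0 ∧ B u w = 1} ≃ V where
  toFun x := x.2.1 + x.1.1 • u + x.1.2 • w₀
  -- Adding a multiple of `w₀` makes the pairing with `u` equal to 1. Adding a multiple of `u` then
  -- makes the vector singular without changing that pairing. So `u` has `|V|/4` partners, a number
  -- independent of `u`.
  invFun v := ((q (v + (B u v + 1) • w₀), B u v + 1),
    ⟨v + (B u v + 1) • w₀ + q (v + (B u v + 1) • w₀) • u, by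
      have h2 : (2 : ZMod 2) = 0 := rfl
      have h1 : B u (v + (B u v + 1) • w₀) = 1 := by
        rw [_root_.map_add, _root_.map_smul, hw₀]
        simp only [smul_eq_mul]
        linear_combination (B u v) * h2
      constructor
      · rw [h.map_add, h.map_smul, hu, _root_.map_smul, h.bilin_comm _ u, h1]
        simp [CharTwo.add_self_eq_zero]
      · rw [_root_.map_add, h1, _root_.map_smul, h.bilin_self]
        simp⟩)
  left_inv := by
    rintro ⟨⟨a, b⟩, ⟨w, hw, hw'⟩⟩
    have e1 := zmod_two_module_add_self (a • u)
    have e2 := zmod_two_module_add_self (b • w₀)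
    have h1 : B u (w + a • u + b • w₀) + 1 = b := by
      have h2 : (2 : ZMod 2) = 0 := rfl
      simp only [_root_.map_add, _root_.map_smul, hw', hw₀, h.bilin_self, smul_eq_mul]
      linear_combination h2
    have h3 : w + a • u + b • w₀ + b • w₀ = w + a • u := by rw [add_assoc, e2, add_zero]
    have h4 : q (w + a • u) = a := by
      rw [h.map_add, h.map_smul, hw, hu, _root_.map_smul, h.bilin_comm, hw']
      simp
    refine Prod.ext (Prod.ext ?_ h1) (Subtype.ext ?_)
    · dsimp only
      rw [h1, h3, h4]
    · dsimp only
      rw [h1, h3, h4, add_assoc, e1, add_zero]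
  right_inv := by
    intro v
    dsimp only
    generalize q (v + (B u v + 1) • w₀) = a
    generalize B u v + 1 = b
    have e1 := zmod_two_module_add_self (a • u)
    have e2 := zmod_two_module_add_self (b • w₀)
    calc v + b • w₀ + a • u + a • u + b • w₀
        = v + (a • u + a • u) + (b • w₀ + b • w₀) := by abel
      _ = v := by rw [e1, e2, add_zero, add_zero]

theorem card_eq_four_mul_card_perp [Finite V] {p : V × V} (hp : IsHypPair q B p) :
    Nat.card V = 4 * Nat.card (pairPerp B p) := by
  rw [← Nat.card_congr (h.splitEquiv hp), Nat.card_prod, Nat.card_prod, Nat.card_zmod]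

theorem card_zeros_eq_card_zeros_hypSum {p : V × V} (hp : IsHypPair q B p) :
    Nat.card {x // q x = 0} =
      Nat.card {x // hypSum (fun y : pairPerp B p => q y) x = 0} :=
  (Nat.card_congr ((h.splitEquiv hp).subtypeEquiv fun x => by rw [h.map_splitEquiv hp])).symm

/-- The first vector of the pair is any nonzero singular `u`, and each such `u` has `|V|/4`
partners. The factor 4 on the left avoids division. -/
theorem four_mul_card_hypPair [Finite V] :
    4 * Nat.card {p : V × V // IsHypPair q B p} =
      (Nat.card {x // q x = 0} - 1) * Nat.card V := by
  have : Fintype V := Fintype.ofFinite V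
  have : Fintype {u : V // q u = 0 ∧ u ≠ 0} := Fintype.ofFinite _
  let e : {p : V × V // IsHypPair q B p} ≃
      Σ u : {u : V // q u = 0 ∧ u ≠ 0}, {w : V // q w = 0 ∧ B u w = 1} :=
    { toFun := fun p => ⟨⟨p.1.1, p.2.1, fun h0 => by
          have := p.2.2.2
          rw [h0] at this
          simp at this⟩, ⟨p.1.2, p.2.2⟩⟩
      invFun := fun x => ⟨(x.1.1, x.2.1), x.1.2.1, x.2.2⟩
      left_inv := fun _ => rfl
      right_inv := fun _ => rfl }
  have hz : Nat.card {u : V // q u = 0 ∧ u ≠ 0} = Nat.card {x // q x = 0} - 1 := by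
    have h1 : Nat.card {u : V // q u = 0 ∧ u ≠ 0} =
        Nat.card ↥({x | q x = 0} \ {0} : Set V) := rfl
    rw [h1, Nat.card_coe_set_eq, Set.ncard_sdiff_singleton_of_mem]
    · rfl
    · exact h.map_zero
  rw [Nat.card_congr e, Nat.card_sigma, Finset.mul_sum, ← hz, Nat.card_eq_fintype_card,
    ← smul_eq_mul, ← Finset.card_univ, ← Finset.sum_const]
  refine Finset.sum_congr rfl fun u _ => ?_
  obtain ⟨w₀, hw₀⟩ := h.exists_eq_one u.2.2
  rw [← Nat.card_congr (h.hypPairEquiv u.2.1 hw₀), Nat.card_prod, Nat.card_prod, Nat.card_zmod]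

/-- The number of form-preserving maps from an orthogonal sum with a hyperbolic plane. -/
theorem four_mul_card_formMaps_hypSum [Finite V] [Finite V'] (q' : V' → ZMod 2) (c : ℕ)
    (hc : ∀ p : V × V, IsHypPair q B p →
      Nat.card (FormMaps q' (fun y : pairPerp B p => q y)) = c) :
    4 * Nat.card (FormMaps (hypSum q') q) =
      (Nat.card {x // q x = 0} - 1) * Nat.card V * c := by
  have : Fintype {p : V × V // IsHypPair q B p} := Fintype.ofFinite _
  have : ∀ p : {p : V × V // IsHypPair q B p}, Finite (V' →ₗ[ZMod 2] pairPerp B p.1) :=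
    fun p => DFunLike.finite _
  rw [Nat.card_congr (h.formMapsEquiv q'), Nat.card_sigma, Finset.sum_congr rfl fun p _ => hc p.1 p.2,
    Finset.sum_const, smul_eq_mul, ← mul_assoc, Finset.card_univ, ← Nat.card_eq_fintype_card,
    h.four_mul_card_hypPair]

end IsNondegQuad

/-- The number of zeros of the orthogonal sum of a hyperbolic plane and `q'`. -/
theorem card_zeros_hypSum {V' : Type*} [Finite V'] (q' : V' → ZMod 2) :
    Nat.card {x // hypSum q' x = 0} = 2 * Nat.card {x // q' x = 0} + Nat.card V' := by
  -- The product `a * b` is 0 for three of the four pairs and 1 for the fourth. With `Z` zeros of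
  -- `q'` the total is `3 Z + (|V'| - Z)`.
  have h1 : Nat.card {y // 1 + q' y = 0} + Nat.card {x // q' x = 0} = Nat.card V' := by
    have h2 : Nat.card {y // 1 + q' y = 0} = ({x | q' x = 0}ᶜ : Set V').ncard := by
      rw [← Nat.card_coe_set_eq]
      refine Nat.card_congr (Equiv.subtypeEquivRight fun y => ?_)
      rw [Set.mem_compl_iff, Set.mem_ofPred_eq]
      generalize q' y = a
      revert a
      decide
    rw [h2, add_comm]
    exact Set.ncard_add_ncard_compl {x | q' x = 0}
  let e : {x // hypSum q' x = 0} ≃ Σ a : ZMod 2 × ZMod 2, {y // a.1 * a.2 + q' y = 0} :=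
    Equiv.subtypeProdEquivSigmaSubtype fun (a : ZMod 2 × ZMod 2) y => a.1 * a.2 + q' y = 0
  have h0 : ∀ f : ZMod 2 × ZMod 2 → ℕ, ∑ a, f a = f (0, 0) + f (0, 1) + (f (1, 0) + f (1, 1)) := by
    intro f
    rw [Fintype.sum_prod_type]
    exact (Fin.sum_univ_two _).trans (congrArg₂ (· + ·) (Fin.sum_univ_two _) (Fin.sum_univ_two _))
  rw [Nat.card_congr e, Nat.card_sigma, h0]
  simp only [mul_zero, mul_one, zero_add]
  omega

/-- The orthogonal sum of a hyperbolic plane and a nondegenerate form is nondegenerate. -/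
theorem IsNondegQuad.exists_hypSum {q' : V' → ZMod 2} {B : LinearMap.BilinForm (ZMod 2) V'}
    (h : IsNondegQuad q' B) : ∃ B', IsNondegQuad (hypSum q') B' := by
  let B' : LinearMap.BilinForm (ZMod 2) ((ZMod 2 × ZMod 2) × V') :=
    LinearMap.mk₂ (ZMod 2) (fun x y => x.1.1 * y.1.2 + x.1.2 * y.1.1 + B x.2 y.2)
      (fun x x' y => by simp; ring) (fun c x y => by simp; ring)
      (fun x y y' => by simp; ring) (fun c x y => by simp; ring)
  have hB' : ∀ x y, B' x y = x.1.1 * y.1.2 + x.1.2 * y.1.1 + B x.2 y.2 := fun _ _ => rfl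
  refine ⟨B', fun x y => ?_, fun x hx => ?_⟩
  · simp only [hypSum, hB', Prod.fst_add, Prod.snd_add, h.map_add]
    ring
  · have h1 := hx ((0, 1), 0)
    have h2 := hx ((1, 0), 0)
    simp only [hB', _root_.map_zero, mul_zero, mul_one, add_zero, zero_add] at h1 h2
    refine Prod.ext (Prod.ext h1 h2) (h.nondeg _ fun y => ?_)
    simpa [hB'] using hx (0, y)

theorem IsNondegQuad.exists_comp {q : V → ZMod 2} {B : LinearMap.BilinForm (ZMod 2) V}
    (h : IsNondegQuad q B) (e : V' ≃ₗ[ZMod 2] V) : ∃ B', IsNondegQuad (fun x => q (e x)) B' := by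
  refine ⟨B.compl₁₂ e.toLinearMap e.toLinearMap, fun x y => ?_, fun x hx => ?_⟩
  · rw [_root_.map_add, h.map_add]
    rfl
  · refine e.map_eq_zero_iff.1 (h.nondeg _ fun y => ?_)
    obtain ⟨y, rfl⟩ := e.surjective y
    exact hx y

/-- Form-preserving maps and linear equivalences of the source. -/
def formMapsCongr {W : Type*} [AddCommGroup W] [Module (ZMod 2) W] (e : W ≃ₗ[ZMod 2] V')
    (q' : V' → ZMod 2) (q : V → ZMod 2) : FormMaps (fun x => q' (e x)) q ≃ FormMaps q' q where
  toFun f := ⟨f.1 ∘ₗ e.symm.toLinearMap, fun x => (f.2 (e.symm x)).trans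
    (congrArg q' (e.apply_symm_apply x))⟩
  invFun f := ⟨f.1 ∘ₗ e.toLinearMap, fun x => f.2 (e x)⟩
  left_inv f := by ext; simp
  right_inv f := by ext; simp

end Quadratic

/-! ## The two standard forms -/

/-- Splitting off the first two coordinates. -/
def splitFirstTwo (d : ℕ) : (Fin (d + 2) → ZMod 2) ≃ₗ[ZMod 2] (ZMod 2 × ZMod 2) × (Fin d → ZMod 2) where
  toFun x := ((x 0, x 1), fun i => x i.succ.succ)
  map_add' _ _ := rfl
  map_smul' _ _ := rfl
  invFun y := Fin.cons y.1.1 (Fin.cons y.1.2 y.2)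
  left_inv x := by
    funext i
    refine Fin.cases rfl (fun i => ?_) i
    exact Fin.cases rfl (fun i => rfl) i
  right_inv y := rfl

theorem eval_PhiPlus (r : ℕ) (x : Fin (2 * r) → ZMod 2) :
    MvPolynomial.eval x (PhiPlus r) =
      ∑ i : Fin r, x ⟨2 * i, by omega⟩ * x ⟨2 * i + 1, by omega⟩ := by
  simp [PhiPlus]

theorem eval_PhiMinus (r : ℕ) (x : Fin (2 * r) → ZMod 2) :
    MvPolynomial.eval x (PhiMinus r) =
      ∑ i : Fin r, (x ⟨2 * i, by omega⟩ * x ⟨2 * i + 1, by omega⟩ +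
        if (i : ℕ) + 1 = r then x ⟨2 * i, by omega⟩ ^ 2 + x ⟨2 * i + 1, by omega⟩ ^ 2 else 0) := by
  simp only [PhiMinus, map_sum, map_add, map_mul, MvPolynomial.eval_X]
  refine Finset.sum_congr rfl fun i _ => ?_
  split_ifs <;> simp

/-- This recursion, and its analogue for `PhiMinus`, drive the inductions on `r` below. -/
theorem eval_PhiPlus_succ (r : ℕ) (x : Fin (2 * (r + 1)) → ZMod 2) :
    MvPolynomial.eval x (PhiPlus (r + 1)) =
      hypSum (fun y => MvPolynomial.eval y (PhiPlus r)) (splitFirstTwo (2 * r) x) := by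
  rw [eval_PhiPlus, Fin.sum_univ_succ, hypSum, eval_PhiPlus]
  rfl

/-- The anisotropic plane sits in the last two coordinates, so it survives when the first two are
split off. The recursion therefore starts from rank one, not zero. -/
theorem eval_PhiMinus_succ (r : ℕ) (x : Fin (2 * (r + 1 + 1)) → ZMod 2) :
    MvPolynomial.eval x (PhiMinus (r + 1 + 1)) =
      hypSum (fun y => MvPolynomial.eval y (PhiMinus (r + 1)))
        (splitFirstTwo (2 * (r + 1)) x) := by
  rw [eval_PhiMinus, Fin.sum_univ_succ, hypSum, eval_PhiMinus]
  rw [if_neg (by simp), add_zero]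
  refine congrArg₂ (· + ·) rfl (Finset.sum_congr rfl fun i _ => ?_)
  simp only [Fin.val_succ, add_left_inj]
  rfl

theorem eval_PhiMinus_one (x : Fin (2 * 1) → ZMod 2) :
    MvPolynomial.eval x (PhiMinus 1) = x 0 * x 1 + (x 0 + x 1) := by
  rw [eval_PhiMinus]
  simp only [Finset.univ_unique, Finset.sum_singleton]
  change x 0 * x 1 + (x 0 ^ 2 + x 1 ^ 2) = _
  rw [ZMod.pow_card, ZMod.pow_card]

theorem exists_isNondegQuad_PhiPlus (r : ℕ) :
    ∃ B, IsNondegQuad (fun x => MvPolynomial.eval x (PhiPlus r)) B := by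
  induction r with
  | zero =>
    refine ⟨0, fun x y => ?_, fun x _ => funext fun i => i.elim0⟩
    simp [PhiPlus]
  | succ r ih =>
    obtain ⟨B, hB⟩ := ih
    obtain ⟨B', hB'⟩ := hB.exists_hypSum
    simp only [eval_PhiPlus_succ]
    exact hB'.exists_comp _

theorem exists_isNondegQuad_PhiMinus_one :
    ∃ B, IsNondegQuad (fun x => MvPolynomial.eval x (PhiMinus 1)) B := by
  refine ⟨LinearMap.mk₂ (ZMod 2) (fun x y => x 0 * y 1 + x 1 * y 0)
    (fun x x' y => by simp; ring) (fun c x y => by simp; ring)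
    (fun x y y' => by simp; ring) (fun c x y => by simp; ring), fun x y => ?_, fun x hx => ?_⟩
  · simp only [eval_PhiMinus_one, LinearMap.mk₂_apply, Pi.add_apply]
    ring
  · have h1 := hx ![0, 1]
    have h2 := hx ![1, 0]
    simp at h1 h2
    funext i
    fin_cases i
    · exact h1
    · exact h2

theorem exists_isNondegQuad_PhiMinus (r : ℕ) :
    ∃ B, IsNondegQuad (fun x => MvPolynomial.eval x (PhiMinus (r + 1))) B := by
  induction r with
  | zero => exact exists_isNondegQuad_PhiMinus_one
  | succ r ih =>
    obtain ⟨B, hB⟩ := ih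
    obtain ⟨B', hB'⟩ := hB.exists_hypSum
    simp only [eval_PhiMinus_succ]
    exact hB'.exists_comp _

/-- The number of zeros satisfies `Z ↦ 2 Z + 4 ^ r`, starting from one zero on the zero space. -/
theorem card_zeros_PhiPlus (r : ℕ) :
    2 * Nat.card {x : Fin (2 * r) → ZMod 2 // MvPolynomial.eval x (PhiPlus r) = 0} =
      4 ^ r + 2 ^ r := by
  induction r with
  | zero => simp [PhiPlus]
  | succ r ih =>
    have h1 := card_zeros_hypSum fun y : Fin (2 * r) → ZMod 2 => MvPolynomial.eval y (PhiPlus r)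
    have e : {x : Fin (2 * (r + 1)) → ZMod 2 // MvPolynomial.eval x (PhiPlus (r + 1)) = 0} ≃
        {x // hypSum (fun y => MvPolynomial.eval y (PhiPlus r)) x = 0} :=
      (splitFirstTwo (2 * r)).toEquiv.subtypeEquiv fun x => by rw [eval_PhiPlus_succ]; rfl
    rw [Nat.card_congr e, h1, mul_add, ih, Nat.card_fun, Nat.card_zmod, Nat.card_fin, pow_mul]
    ring

/-- The same recursion as for `PhiPlus`, starting from the anisotropic plane, whose only zero is the
origin. -/
theorem card_zeros_PhiMinus (r : ℕ) :
    2 * Nat.card {x : Fin (2 * (r + 1)) → ZMod 2 // MvPolynomial.eval x (PhiMinus (r + 1)) = 0} +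
      2 ^ (r + 1) = 4 ^ (r + 1) := by
  induction r with
  | zero =>
    have : Nat.card {x : Fin (2 * 1) → ZMod 2 // MvPolynomial.eval x (PhiMinus 1) = 0} = 1 := by
      simp only [eval_PhiMinus_one]
      rw [Nat.card_eq_fintype_card]
      decide
    change 2 * Nat.card {x : Fin (2 * 1) → ZMod 2 // MvPolynomial.eval x (PhiMinus 1) = 0} + _ = _
    rw [this]
    rfl
  | succ r ih =>
    have h1 := card_zeros_hypSum fun y : Fin (2 * (r + 1)) → ZMod 2 =>
      MvPolynomial.eval y (PhiMinus (r + 1))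
    have e : {x : Fin (2 * (r + 1 + 1)) → ZMod 2 //
          MvPolynomial.eval x (PhiMinus (r + 1 + 1)) = 0} ≃
        {x // hypSum (fun y => MvPolynomial.eval y (PhiMinus (r + 1))) x = 0} :=
      (splitFirstTwo (2 * (r + 1))).toEquiv.subtypeEquiv fun x => by rw [eval_PhiMinus_succ]; rfl
    rw [Nat.card_congr e, h1, Nat.card_fun, Nat.card_zmod, Nat.card_fin, pow_mul, pow_succ 4 (r + 1),
      pow_succ 2 (r + 1)]
    have h4 : (2 ^ 2) ^ (r + 1) = 4 ^ (r + 1) := rfl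
    omega

/-! ## Orders of the orthogonal groups -/

section Count

universe u

/-- The number of isometries from the standard form of Arf invariant `+1` to a nondegenerate form
with as many zeros. -/
theorem card_formMaps_PhiPlus (r : ℕ) : ∀ (V : Type u) [AddCommGroup V] [Module (ZMod 2) V]
    [Finite V] (q : V → ZMod 2) (B : LinearMap.BilinForm (ZMod 2) V), IsNondegQuad q B →
    Nat.card V = 4 ^ r → 2 * Nat.card {x // q x = 0} = 4 ^ r + 2 ^ r →
    Nat.card (FormMaps (fun x => MvPolynomial.eval x (PhiPlus r)) q) =
      ∏ i ∈ Finset.range r, (2 ^ (i + 1) - 1) * (2 ^ i + 1) * 4 ^ i := by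
  induction r with
  | zero =>
    intro V _ _ _ q B h hV _
    have : Subsingleton V := (Nat.card_eq_one_iff_unique.1 hV).1
    rw [Finset.prod_range_zero, Nat.card_eq_one_iff_unique]
    refine ⟨⟨fun f g => Subtype.ext (LinearMap.ext fun x => Subsingleton.elim _ _)⟩,
      ⟨⟨0, fun x => ?_⟩⟩⟩
    simp [PhiPlus, h.map_zero]
  | succ r ih =>
    intro V _ _ _ q B h hV hz
    -- The complement of any hyperbolic pair has a quarter of the vectors, and its number of zeros
    -- is found by inverting `card_zeros_hypSum`. So the induction hypothesis applies to it without
    -- a cancellation theorem. This is why the statement ranges over abstract spaces and measures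
    -- the form by its zeros.
    have h4 := h.four_mul_card_formMaps_hypSum
      (fun y : Fin (2 * r) → ZMod 2 => MvPolynomial.eval y (PhiPlus r)) _ (fun p hp => by
        have h1 := h.card_eq_four_mul_card_perp hp
        have h2 := h.card_zeros_eq_card_zeros_hypSum hp
        rw [card_zeros_hypSum] at h2
        rw [pow_succ] at hV hz
        rw [pow_succ 2] at hz
        exact ih (pairPerp B p) _ _ (h.perp hp) (by omega) (by omega))
    have h6 : Nat.card (FormMaps (fun x => MvPolynomial.eval x (PhiPlus (r + 1))) q) =
        Nat.card (FormMaps (hypSum fun y => MvPolynomial.eval y (PhiPlus r)) q) := by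
      simp only [eval_PhiPlus_succ]
      exact Nat.card_congr (formMapsCongr (splitFirstTwo (2 * r)) _ q)
    rw [h6, Finset.prod_range_succ]
    -- With `x = 2 ^ r`, this is `2 x² + x - 1 = (2 x - 1)(x + 1)`; below, `t = x - 1` avoids
    -- subtraction.
    have hz' : Nat.card {x // q x = 0} - 1 = (2 ^ (r + 1) - 1) * (2 ^ r + 1) := by
      have e4 : (4 : ℕ) ^ r = 2 ^ r * 2 ^ r := by rw [← mul_pow]; rfl
      have hpos : 1 ≤ 2 ^ r := Nat.one_le_two_pow
      rw [pow_succ, pow_succ 2, e4] at hz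
      rw [pow_succ]
      obtain ⟨t, ht⟩ := Nat.exists_eq_add_of_le hpos
      rw [ht] at hz ⊢
      have : (1 + t) * 2 - 1 = 2 * t + 1 := by omega
      rw [this]
      have : Nat.card {x // q x = 0} = (2 * t + 1) * (1 + t + 1) + 1 := by linarith
      omega
    rw [hz', hV] at h4
    have h5 : (4 : ℕ) ^ (r + 1) = 4 * 4 ^ r := pow_succ' 4 r
    rw [h5] at h4
    refine Nat.eq_of_mul_eq_mul_left (by norm_num : 0 < 4) (h4.trans ?_)
    ring

/-- Both forms are anisotropic, hence equal to 1 at every nonzero vector. A linear map preserves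
them exactly when it is injective, so ordered bases of `F₂²` are counted: `3 * 2`. -/
theorem card_formMaps_PhiMinus_one (V : Type u) [AddCommGroup V] [Module (ZMod 2) V]
    [Finite V] (q : V → ZMod 2) (B : LinearMap.BilinForm (ZMod 2) V) (h : IsNondegQuad q B)
    (hV : Nat.card V = 4) (hz : Nat.card {x // q x = 0} = 1) :
    Nat.card (FormMaps (fun x => MvPolynomial.eval x (PhiMinus 1)) q) = 6 := by
  have hq : ∀ x, q x = 0 ↔ x = 0 := by
    intro x
    constructor
    · intro h0
      have := (Nat.card_eq_one_iff_unique.1 hz).1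
      exact congrArg Subtype.val
        (Subsingleton.elim (⟨x, h0⟩ : {x // q x = 0}) ⟨0, h.map_zero⟩)
    · rintro rfl
      exact h.map_zero
  have hΦ : ∀ x : Fin (2 * 1) → ZMod 2, MvPolynomial.eval x (PhiMinus 1) = 0 ↔ x = 0 := by
    intro x
    rw [eval_PhiMinus_one]
    revert x
    decide
  have heq : ∀ a b : ZMod 2, (a = 0 ↔ b = 0) → a = b := by decide
  have hdim : Module.finrank (ZMod 2) V = 2 := by
    have h1 := Module.natCard_eq_pow_finrank (K := ZMod 2) (V := V)
    rw [hV, Nat.card_zmod] at h1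
    exact (Nat.pow_right_injective le_rfl (h1.symm.trans (by norm_num : 4 = 2 ^ 2)))
  have hcard := card_linearIndependent (K := ZMod 2) (V := V) (k := 2) hdim.ge
  let e : FormMaps (fun x => MvPolynomial.eval x (PhiMinus 1)) q ≃
      {s : Fin 2 → V // LinearIndependent (ZMod 2) s} :=
    ((Pi.basisFun (ZMod 2) (Fin 2)).constr (ZMod 2)).symm.toEquiv.subtypeEquiv fun f => by
      have hf : ∀ g : Fin 2 → ZMod 2, ∑ i, g i • f (Pi.basisFun (ZMod 2) (Fin 2) i) = f g := by
        intro g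
        rw [← (Pi.basisFun (ZMod 2) (Fin 2)).sum_repr g, map_sum]
        simp
      rw [Fintype.linearIndependent_iff]
      change _ ↔ ∀ g : Fin 2 → ZMod 2, ∑ i, g i • f (Pi.basisFun (ZMod 2) (Fin 2) i) = 0 → _
      simp only [hf]
      constructor
      · intro hx g hg i
        have h0 := hx g
        rw [hg, h.map_zero] at h0
        exact congrFun ((hΦ g).1 h0.symm) i
      · intro hx x
        refine heq _ _ ((hq _).trans (Iff.trans ⟨fun h0 => funext (hx x h0), ?_⟩ (hΦ x).symm))
        rintro rfl
        exact map_zero f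
  rw [Nat.card_congr e, hcard, hdim]
  simp

/-- The induction of `card_formMaps_PhiPlus`, with the anisotropic plane and its six isometries as
the base. -/
theorem card_formMaps_PhiMinus (r : ℕ) : ∀ (V : Type u) [AddCommGroup V] [Module (ZMod 2) V]
    [Finite V] (q : V → ZMod 2) (B : LinearMap.BilinForm (ZMod 2) V), IsNondegQuad q B →
    Nat.card V = 4 ^ (r + 1) → 2 * Nat.card {x // q x = 0} + 2 ^ (r + 1) = 4 ^ (r + 1) →
    Nat.card (FormMaps (fun x => MvPolynomial.eval x (PhiMinus (r + 1))) q) =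
      6 * ∏ i ∈ Finset.range r, (2 ^ (i + 2) + 1) * (2 ^ (i + 1) - 1) * 4 ^ (i + 1) := by
  induction r with
  | zero =>
    intro V _ _ _ q B h hV hz
    exact card_formMaps_PhiMinus_one V q B h hV (by norm_num at hz; omega)
  | succ r ih =>
    intro V _ _ _ q B h hV hz
    have h4 := h.four_mul_card_formMaps_hypSum
      (fun y : Fin (2 * (r + 1)) → ZMod 2 => MvPolynomial.eval y (PhiMinus (r + 1))) _
      (fun p hp => by
        have h1 := h.card_eq_four_mul_card_perp hp
        have h2 := h.card_zeros_eq_card_zeros_hypSum hp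
        rw [card_zeros_hypSum] at h2
        rw [pow_succ] at hV hz
        rw [pow_succ 4 (r + 1)] at hz
        exact ih (pairPerp B p) _ _ (h.perp hp) (by omega) (by omega))
    have h6 : Nat.card (FormMaps (fun x => MvPolynomial.eval x (PhiMinus (r + 1 + 1))) q) =
        Nat.card (FormMaps (hypSum fun y => MvPolynomial.eval y (PhiMinus (r + 1))) q) := by
      simp only [eval_PhiMinus_succ]
      exact Nat.card_congr (formMapsCongr (splitFirstTwo (2 * (r + 1))) _ q)
    rw [h6, Finset.prod_range_succ]
    -- With `x = 2 ^ (r + 1)`, this is `2 x² - x - 1 = (2 x + 1)(x - 1)`.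
    have hz' : Nat.card {x // q x = 0} - 1 = (2 ^ (r + 2) + 1) * (2 ^ (r + 1) - 1) := by
      have e4 : (4 : ℕ) ^ (r + 1) = 2 ^ (r + 1) * 2 ^ (r + 1) := by rw [← mul_pow]; rfl
      have hpos : 1 ≤ 2 ^ (r + 1) := Nat.one_le_two_pow
      rw [pow_succ, pow_succ 4 (r + 1), e4] at hz
      rw [pow_succ 2 (r + 1)]
      obtain ⟨t, ht⟩ := Nat.exists_eq_add_of_le hpos
      rw [ht] at hz ⊢
      rw [Nat.add_sub_cancel_left]
      have : Nat.card {x // q x = 0} = ((1 + t) * 2 + 1) * t + 1 := by linarith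
      omega
    rw [hz', hV] at h4
    have h5 : (4 : ℕ) ^ (r + 1 + 1) = 4 * 4 ^ (r + 1) := pow_succ' 4 _
    rw [h5] at h4
    refine Nat.eq_of_mul_eq_mul_left (by norm_num : 0 < 4) (h4.trans ?_)
    ring

end Count

/-- The orthogonal group of a nondegenerate form as a set of linear maps. -/
theorem card_formOrthogonalGroup {m : ℕ} (p : MvPolynomial (Fin m) (ZMod 2))
    {B : LinearMap.BilinForm (ZMod 2) (Fin m → ZMod 2)}
    (h : IsNondegQuad (fun x => MvPolynomial.eval x p) B) :
    Nat.card (formOrthogonalGroup p) =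
      Nat.card (FormMaps (fun x => MvPolynomial.eval x p) (fun x => MvPolynomial.eval x p)) := by
  refine Nat.card_congr (Equiv.ofBijective
    (fun A => ⟨Matrix.toLin' A.1.val, fun x => A.2 x⟩) ⟨fun A A' hA => ?_, fun f => ?_⟩)
  · exact Subtype.ext (Units.ext (Matrix.toLin'.injective (congrArg Subtype.val hA)))
  · have hf := h.formMap_injective f.1 f.2
    have hu : IsUnit (LinearMap.toMatrix' f.1) := by
      rw [LinearMap.isUnit_toMatrix'_iff]
      exact (LinearMap.isUnit_iff_ker_eq_bot _).2 (LinearMap.ker_eq_bot.2 hf)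
    refine ⟨⟨hu.unit, fun v => ?_⟩, Subtype.ext ?_⟩
    · rw [IsUnit.unit_spec, ← Matrix.toLin'_apply, Matrix.toLin'_toMatrix']
      exact f.2 v
    · exact Matrix.toLin'_toMatrix' f.1

theorem card_fin_fun (r : ℕ) : Nat.card (Fin (2 * r) → ZMod 2) = 4 ^ r := by
  rw [Nat.card_fun, Nat.card_zmod, Nat.card_fin, pow_mul]
  rfl

theorem two_pow_add_one_mul (i : ℕ) : (2 ^ i + 1) * (2 ^ i - 1) * 4 ^ i = (2 ^ (2 * i) - 1) * 2 ^ (2 * i) := by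
  rw [← Nat.sq_sub_sq, ← pow_mul, one_pow, mul_comm i 2, pow_mul 2 2 i]
  rfl

/-- The isometries of the form with itself are counted. The factors `2 ^ i + 1` and `2 ^ i - 1` come
from consecutive stages of the product; paired as in `two_pow_add_one_mul`, they leave `2 ^ 0 + 1 =
2` and the last `2 ^ (r + 1) - 1`. -/
theorem card_OPlus (r : ℕ) : Nat.card (OPlus (r + 1)) =
    2 * (2 ^ (r + 1) - 1) * ∏ i ∈ Finset.Icc 1 r, ((2 ^ (2 * i) - 1) * 2 ^ (2 * i)) := by
  obtain ⟨B, hB⟩ := exists_isNondegQuad_PhiPlus (r + 1)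
  rw [OPlus, card_formOrthogonalGroup _ hB,
    card_formMaps_PhiPlus (r + 1) _ _ B hB (card_fin_fun _) (card_zeros_PhiPlus _)]
  clear hB B
  induction r with
  | zero => simp
  | succ r ih =>
    rw [Finset.prod_range_succ, ih, Finset.prod_Icc_succ_top (by omega), ← two_pow_add_one_mul]
    ring

/-- The same regrouping, where the base value `6 = 2 * (2 ^ 1 + 1)` supplies the first factor and `2
^ (r + 1) + 1` is left over. -/
theorem card_OMinus (r : ℕ) : Nat.card (OMinus (r + 1)) =
    2 * (2 ^ (r + 1) + 1) * ∏ i ∈ Finset.Icc 1 r, ((2 ^ (2 * i) - 1) * 2 ^ (2 * i)) := by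
  obtain ⟨B, hB⟩ := exists_isNondegQuad_PhiMinus r
  rw [OMinus, card_formOrthogonalGroup _ hB,
    card_formMaps_PhiMinus r _ _ B hB (card_fin_fun _) (card_zeros_PhiMinus _)]
  clear hB B
  induction r with
  | zero => simp
  | succ r ih =>
    rw [Finset.prod_range_succ, ← mul_assoc, ih, Finset.prod_Icc_succ_top (by omega),
      ← two_pow_add_one_mul]
    ring

/-! ## An element of order three that preserves both forms -/

theorem eval_PhiPlus_two (x : Fin (2 * 2) → ZMod 2) :
    MvPolynomial.eval x (PhiPlus 2) = x 0 * x 1 + x 2 * x 3 := by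
  rw [eval_PhiPlus, Fin.sum_univ_two]
  rfl

theorem eval_PhiMinus_two (x : Fin (2 * 2) → ZMod 2) :
    MvPolynomial.eval x (PhiMinus 2) = x 0 * x 1 + (x 2 * x 3 + (x 2 + x 3)) := by
  rw [eval_PhiMinus_succ, hypSum]
  exact congrArg (x 0 * x 1 + ·) (eval_PhiMinus_one _)

theorem exists_isometry_cube_eq_id_two :
    ∃ f : (Fin (2 * 2) → ZMod 2) →ₗ[ZMod 2] (Fin (2 * 2) → ZMod 2),
      (∀ x, f (f (f x)) = x) ∧ (∃ x, f x ≠ x) ∧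
      (∀ x, MvPolynomial.eval (f x) (PhiPlus 2) = MvPolynomial.eval x (PhiPlus 2)) ∧
      (∀ x, MvPolynomial.eval (f x) (PhiMinus 2) = MvPolynomial.eval x (PhiMinus 2)) := by
  -- The forms differ by `x₂ + x₃`, which is pairing with `z = e₂ + e₃`. The map fixes `z` and acts
  -- on the plane `z^⊥ / z` by `(x₀, x₁) ↦ (x₁, x₀ + x₁)`, of order 3.
  refine ⟨{
    toFun := fun x => ![x 1, x 0 + x 1 + x 2 + x 3, x 1 + x 3, x 1 + x 2]
    map_add' := by decide
    map_smul' := by decide }, ?_, ?_, ?_, ?_⟩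
  · change ∀ x : Fin 4 → ZMod 2, _
    decide
  · exact ⟨![1, 0, 0, 0], by decide⟩
  · simp only [eval_PhiPlus_two]
    decide
  · simp only [eval_PhiMinus_two]
    decide

/-- The rank four isometry extends by the identity on each further hyperbolic plane. -/
theorem exists_isometry_cube_eq_id (r : ℕ) :
    ∃ f : (Fin (2 * (r + 2)) → ZMod 2) →ₗ[ZMod 2] (Fin (2 * (r + 2)) → ZMod 2),
      (∀ x, f (f (f x)) = x) ∧ (∃ x, f x ≠ x) ∧
      (∀ x, MvPolynomial.eval (f x) (PhiPlus (r + 2)) = MvPolynomial.eval x (PhiPlus (r + 2))) ∧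
      (∀ x, MvPolynomial.eval (f x) (PhiMinus (r + 2)) =
        MvPolynomial.eval x (PhiMinus (r + 2))) := by
  induction r with
  | zero => exact exists_isometry_cube_eq_id_two
  | succ r ih =>
    obtain ⟨f, h3, ⟨x₀, h0⟩, hp, hm⟩ := ih
    let e := splitFirstTwo (2 * (r + 2))
    let f' := e.symm.toLinearMap ∘ₗ (LinearMap.id.prodMap f) ∘ₗ e.toLinearMap
    have hf' : ∀ x, e (f' x) = ((e x).1, f (e x).2) := fun x => e.apply_symm_apply _
    refine ⟨f', fun x => ?_, ⟨e.symm (0, x₀), fun h => ?_⟩, fun x => ?_, fun x => ?_⟩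
    · apply e.injective
      rw [hf', hf', hf']
      exact Prod.ext rfl (h3 _)
    · have h1 := congrArg e h
      rw [hf', e.apply_symm_apply] at h1
      exact h0 (congrArg Prod.snd h1)
    · rw [eval_PhiPlus_succ, eval_PhiPlus_succ]
      change hypSum _ (e (f' x)) = hypSum _ (e x)
      rw [hf']
      exact congrArg ((e x).1.1 * (e x).1.2 + ·) (hp _)
    · rw [eval_PhiMinus_succ, eval_PhiMinus_succ]
      change hypSum _ (e (f' x)) = hypSum _ (e x)
      rw [hf']
      exact congrArg ((e x).1.1 * (e x).1.2 + ·) (hm _)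

theorem three_dvd_card_OPlus_inf_OMinus (r : ℕ) :
    3 ∣ Nat.card (OPlus (r + 2) ⊓ OMinus (r + 2) : Subgroup (GL (Fin (2 * (r + 2))) (ZMod 2))) := by
  obtain ⟨f, h3, ⟨x₀, h0⟩, hp, hm⟩ := exists_isometry_cube_eq_id r
  have h3' : f ∘ₗ f ∘ₗ f = LinearMap.id := LinearMap.ext h3
  let A : GL (Fin (2 * (r + 2))) (ZMod 2) :=
    ⟨LinearMap.toMatrix' f, LinearMap.toMatrix' (f ∘ₗ f),
      by rw [← LinearMap.toMatrix'_comp, h3', LinearMap.toMatrix'_id],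
      by rw [← LinearMap.toMatrix'_comp, LinearMap.comp_assoc, h3', LinearMap.toMatrix'_id]⟩
  have hA : ∀ x, A.val.mulVec x = f x := fun x => LinearMap.toMatrix'_mulVec f x
  let A' : (OPlus (r + 2) ⊓ OMinus (r + 2) : Subgroup (GL (Fin (2 * (r + 2))) (ZMod 2))) :=
    ⟨A, fun x => by rw [hA, hp], fun x => by rw [hA, hm]⟩
  have : Fact (Nat.Prime 3) := ⟨Nat.prime_three⟩
  have ho : orderOf A' = 3 := by
    refine orderOf_eq_prime (Subtype.ext (Units.ext ?_)) fun h => h0 ?_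
    · change A.val ^ 3 = 1
      rw [pow_succ, pow_two, mul_assoc]
      change LinearMap.toMatrix' f * (LinearMap.toMatrix' f * LinearMap.toMatrix' f) = 1
      rw [← LinearMap.toMatrix'_comp, ← LinearMap.toMatrix'_comp, h3', LinearMap.toMatrix'_id]
    · have h1 : A.val = 1 := congrArg (fun u => u.1.val) h
      rw [← hA, h1, Matrix.one_mulVec]
  rw [← ho]
  exact orderOf_dvd_natCard A'

/-! ## The groups of block matrices -/

/-- In `∏ (2 ^ (k + 1) - 2 ^ i)` the first factor is `2 ^ (k + 1) - 1`, and the others are twice the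
factors for `k`. -/
theorem card_GL_zmod_two (k : ℕ) :
    Nat.card (GL (Fin k) (ZMod 2)) = ∏ i ∈ Finset.Icc 1 k, ((2 ^ i - 1) * 2 ^ (i - 1)) := by
  rw [Matrix.card_GL_field, ZMod.card]
  induction k with
  | zero => simp
  | succ k ih =>
    rw [Finset.prod_Icc_succ_top (by omega), ← ih, Fin.prod_univ_succ]
    have h : ∀ i : Fin k, 2 ^ (k + 1) - 2 ^ (i.succ : ℕ) = 2 * (2 ^ k - 2 ^ (i : ℕ)) := by
      intro i
      rw [Fin.val_succ, pow_succ, pow_succ, Nat.mul_sub]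
      ring_nf
    rw [Finset.prod_congr rfl fun i _ => h i, Finset.prod_mul_distrib, Finset.prod_const]
    simp
    ring

/-- A lower block triangular matrix with upper left block the identity. -/
def lowerBlock {j k : ℕ} (C : Matrix (Fin k) (Fin j) (ZMod 2)) (D : Matrix (Fin k) (Fin k) (ZMod 2)) :
    Matrix (Fin (j + k)) (Fin (j + k)) (ZMod 2) :=
  (Matrix.fromBlocks 1 0 C D).submatrix finSumFinEquiv.symm finSumFinEquiv.symm

theorem det_lowerBlock {j k : ℕ} (C : Matrix (Fin k) (Fin j) (ZMod 2))
    (D : Matrix (Fin k) (Fin k) (ZMod 2)) : (lowerBlock C D).det = D.det := by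
  rw [lowerBlock, Matrix.det_submatrix_equiv_self, Matrix.det_fromBlocks_zero₁₂, Matrix.det_one,
    one_mul]

/-- The lower left block is arbitrary. The determinant equals that of the lower right block, which
is therefore an arbitrary element of the smaller general linear group. -/
theorem card_lowerParabolic_add (j k : ℕ) :
    Nat.card (lowerParabolic (j + k) j) = 2 ^ (j * k) * Nat.card (GL (Fin k) (ZMod 2)) := by
  let φ : Matrix (Fin k) (Fin j) (ZMod 2) × GL (Fin k) (ZMod 2) → lowerParabolic (j + k) j :=
    fun x => ⟨Matrix.GeneralLinearGroup.mk'' (lowerBlock x.1 x.2.val) (by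
      rw [det_lowerBlock]
      exact (Matrix.isUnit_iff_isUnit_det _).1 x.2.isUnit), by
        intro i hi l
        obtain ⟨i, rfl⟩ : ∃ i' : Fin j, i = Fin.castAdd k i' := ⟨⟨i, hi⟩, rfl⟩
        obtain ⟨l | l, rfl⟩ := finSumFinEquiv.surjective l
        · change lowerBlock x.1 x.2.val (Fin.castAdd k i) (Fin.castAdd k l) = _
          simp [lowerBlock, Matrix.one_apply]
        · change lowerBlock x.1 x.2.val (Fin.castAdd k i) (Fin.natAdd j l) = _
          simp [lowerBlock, Matrix.one_apply, Fin.ext_iff]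
          omega⟩
  have hφ : ∀ x, (φ x).1.val = lowerBlock x.1 x.2.val := fun _ => rfl
  have hbij : Function.Bijective φ := by
    constructor
    · intro x y h
      have h1 : lowerBlock x.1 x.2.val = lowerBlock y.1 y.2.val := by rw [← hφ, ← hφ, h]
      have h2 := (Matrix.fromBlocks_inj.1
        ((Matrix.reindex finSumFinEquiv finSumFinEquiv).injective h1)).2.2
      exact Prod.ext h2.1 (Units.ext h2.2)
    · intro T
      let M := T.1.val.submatrix (finSumFinEquiv (m := j) (n := k)) finSumFinEquiv
      have hM : lowerBlock M.toBlocks₂₁ M.toBlocks₂₂ = T.1.val := by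
        have h1 : M = Matrix.fromBlocks 1 0 M.toBlocks₂₁ M.toBlocks₂₂ := by
          conv_lhs => rw [← Matrix.fromBlocks_toBlocks M]
          congr 1
          · ext i l
            refine (T.2 (Fin.castAdd k i) i.2 _).trans ?_
            simp [Matrix.one_apply]
          · ext i l
            refine (T.2 (Fin.castAdd k i) i.2 _).trans ?_
            simp [Matrix.one_apply, Fin.ext_iff]
            omega
        rw [lowerBlock, ← h1]
        ext
        simp [M]
      have hu : IsUnit M.toBlocks₂₂ := by
        rw [Matrix.isUnit_iff_isUnit_det, ← det_lowerBlock M.toBlocks₂₁, hM]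
        exact (Matrix.isUnit_iff_isUnit_det _).1 T.1.isUnit
      exact ⟨(M.toBlocks₂₁, hu.unit), Subtype.ext (Units.ext hM)⟩
  rw [← Nat.card_congr (Equiv.ofBijective φ hbij), Nat.card_prod]
  congr 1
  rw [Matrix, Nat.card_fun, Nat.card_fun, Nat.card_zmod, Nat.card_fin, Nat.card_fin, ← pow_mul]

theorem card_lowerParabolic {n j : ℕ} (hj : j ≤ n) :
    Nat.card (lowerParabolic n j) =
      2 ^ (j * (n - j)) * ∏ i ∈ Finset.Icc 1 (n - j), ((2 ^ i - 1) * 2 ^ (i - 1)) := by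
  obtain ⟨k, rfl⟩ := Nat.exists_eq_add_of_le hj
  rw [card_lowerParabolic_add, card_GL_zmod_two, Nat.add_sub_cancel_left]

theorem sumExtend_inl {K V ι : Type*} [Field K] [AddCommGroup V] [Module K V] (a : ι → V)
    (ha : LinearIndependent K a) (i : ι) : Module.Basis.sumExtend ha (Sum.inl i) = a i := by
  rw [Module.Basis.sumExtend, Module.Basis.reindex_apply, Module.Basis.extend_apply_self]
  rfl

/-- Linearly independent vectors are the first rows of an invertible matrix. -/
theorem exists_GL_rows {n j : ℕ} (a : Fin j → Fin n → ZMod 2) (ha : LinearIndependent (ZMod 2) a) :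
    ∃ g : GL (Fin n) (ZMod 2), ∀ i : Fin n, ∀ hi : (i : ℕ) < j, g.val i = a ⟨i, hi⟩ := by
  let b := Module.Basis.sumExtend ha
  have : Finite (Fin j ⊕ Module.Basis.sumExtendIndex ha) := Module.Finite.finite_basis b
  have hfin : Finite (Module.Basis.sumExtendIndex ha) := Finite.sum_right (Fin j)
  obtain ⟨k, ⟨e⟩⟩ := finite_iff_exists_equiv_fin.1 hfin
  have hn : j + k = n := by
    have h1 := Module.finrank_eq_nat_card_basis b
    rw [Module.finrank_fin_fun, Nat.card_sum, Nat.card_congr e, Nat.card_fin, Nat.card_fin] at h1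
    exact h1.symm
  let b' := b.reindex (((Equiv.refl (Fin j)).sumCongr e).trans (finSumFinEquiv.trans (finCongr hn)))
  have hu : IsUnit (Matrix.of fun i => b' i) :=
    Matrix.linearIndependent_rows_iff_isUnit.1 b'.linearIndependent
  refine ⟨hu.unit, fun i hi => ?_⟩
  have h1 : (finSumFinEquiv (m := j) (n := k)).symm ((finCongr hn).symm i) = Sum.inl ⟨i, hi⟩ := by
    rw [Equiv.symm_apply_eq]
    rfl
  change b' i = _
  rw [Module.Basis.reindex_apply]
  simp only [Equiv.symm_trans_apply, h1]
  exact sumExtend_inl a ha ⟨i, hi⟩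

/-- The group of matrices that fix linearly independent row vectors is conjugate to a group of block
matrices. -/
theorem subgroupConj_lowerParabolic {n j : ℕ} (a : Fin j → Fin n → ZMod 2)
    (ha : LinearIndependent (ZMod 2) a) (K : Subgroup (GL (Fin n) (ZMod 2)))
    (hK : ∀ T, T ∈ K ↔ ∀ i, Matrix.vecMul (a i) T⁻¹.val = a i) :
    SubgroupConj K (lowerParabolic n j) := by
  have hjn : j ≤ n := by simpa using ha.fintype_card_le_finrank
  obtain ⟨g, hg⟩ := exists_GL_rows a ha
  have hrow : ∀ (A B : GL (Fin n) (ZMod 2)) (i : Fin n),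
      (A * B).val i = Matrix.vecMul (A.val i) B.val := fun A B i => rfl
  have hmem : ∀ T, T ∈ lowerParabolic n j ↔
      ∀ i : Fin n, (i : ℕ) < j → T.val i = (1 : GL (Fin n) (ZMod 2)).val i :=
    fun T => ⟨fun h i hi => funext (h i hi), fun h i hi l => congrFun (h i hi) l⟩
  refine ⟨g, ?_⟩
  ext T
  rw [Subgroup.mem_map_equiv, MulAut.conj_symm_apply, hK, ← inv_mem_iff, hmem]
  -- The matrix `g` has the `a i` as first rows, so it carries the standard row vectors to them.
  -- Conjugation by `g` turns fixing `a i` into having a standard `i`-th row.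
  have key : ∀ i : Fin j, Matrix.vecMul (a i) (g⁻¹ * T * g)⁻¹.val = a i ↔
      (T⁻¹).val (Fin.castLE hjn i) = (1 : GL (Fin n) (ZMod 2)).val (Fin.castLE hjn i) := by
    intro i
    have h1 : a i = g.val (Fin.castLE hjn i) := (hg (Fin.castLE hjn i) i.2).symm
    have h2 : g * (g⁻¹ * T * g)⁻¹ = T⁻¹ * g := by group
    rw [h1, ← hrow, h2]
    constructor
    · intro h
      have h3 := congrArg (fun v => Matrix.vecMul v g⁻¹.val) h
      simp only [← hrow] at h3
      rwa [mul_inv_cancel_right, mul_inv_cancel] at h3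
    · intro h
      rw [hrow, h, ← hrow, one_mul]
  constructor
  · intro h i hi
    exact (key ⟨i, hi⟩).1 (h _)
  · intro h i
    exact (key i).2 (h _ i.2)

/-! ## Isotropy groups of classes of quadratic forms -/

theorem formCocycle_add {m : ℕ} (p p' : MvPolynomial (Fin m) (ZMod 2)) (u v : Fin m → ZMod 2) :
    formCocycle (p + p') u v = formCocycle p u v + formCocycle p' u v := by
  simp [formCocycle, add_mul, Finset.sum_add_distrib]

theorem formCocycle_sum {m : ℕ} {ι : Type*} (s : Finset ι) (p : ι → MvPolynomial (Fin m) (ZMod 2))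
    (u v : Fin m → ZMod 2) :
    formCocycle (∑ i ∈ s, p i) u v = ∑ i ∈ s, formCocycle (p i) u v :=
  map_sum (AddMonoidHom.mk' (fun p => formCocycle p u v) fun p p' => formCocycle_add p p' u v) p s

theorem formCocycle_zero {m : ℕ} (u v : Fin m → ZMod 2) : formCocycle 0 u v = 0 := by
  simp [formCocycle]

theorem formCocycle_X_mul_X {m : ℕ} {a b : Fin m} (hab : a ≤ b) (u v : Fin m → ZMod 2) :
    formCocycle (MvPolynomial.X a * MvPolynomial.X b) u v = u a * v b := by
  -- The exponent determines only the unordered pair `{i, j}`; the inequalities `i ≤ j` and `a ≤ b`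
  -- rule out the swapped match.
  have hc : ∀ i j : Fin m, i ≤ j →
      (MvPolynomial.X a * MvPolynomial.X b : MvPolynomial (Fin m) (ZMod 2)).coeff
        (Finsupp.single i 1 + Finsupp.single j 1) = if i = a ∧ j = b then 1 else 0 := by
    intro i j hij
    rw [MvPolynomial.X, MvPolynomial.X, MvPolynomial.monomial_mul, MvPolynomial.coeff_monomial,
      one_mul]
    refine if_congr ?_ rfl rfl
    constructor
    · intro h
      have ha := DFunLike.congr_fun h a
      have hb := DFunLike.congr_fun h b
      simp only [Finsupp.add_apply, Finsupp.single_apply] at ha hb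
      by_cases h1 : i = a <;> by_cases h2 : j = b <;> by_cases h3 : i = b <;>
        by_cases h4 : j = a <;> simp_all
      exact absurd (le_antisymm hab hij) (by tauto)
    · rintro ⟨rfl, rfl⟩
      rfl
  rw [formCocycle, Finset.sum_eq_single a, Finset.sum_eq_single b]
  · rw [hc a b hab, if_pos ⟨rfl, rfl⟩, one_mul]
  · intro j hj hjb
    rw [hc a j (Finset.mem_Ici.1 hj), if_neg (by tauto), zero_mul]
  · intro h
    exact absurd (Finset.mem_Ici.2 hab) h
  · intro i _ hi
    refine Finset.sum_eq_zero fun j hj => ?_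
    rw [hc i j (Finset.mem_Ici.1 hj), if_neg (by tauto), zero_mul]
  · simp

/-- On the diagonal, the cocycle of a product of variables is its value, so the diagonal of the
class is the form itself. -/
theorem formCocycle_PhiPlus_self (r : ℕ) (v : Fin (2 * r) → ZMod 2) :
    formCocycle (PhiPlus r) v v = MvPolynomial.eval v (PhiPlus r) := by
  rw [eval_PhiPlus, PhiPlus, formCocycle_sum]
  exact Finset.sum_congr rfl fun i _ => formCocycle_X_mul_X (Fin.mk_le_mk.2 (by omega)) v v

theorem formCocycle_PhiMinus_self (r : ℕ) (v : Fin (2 * r) → ZMod 2) :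
    formCocycle (PhiMinus r) v v = MvPolynomial.eval v (PhiMinus r) := by
  rw [eval_PhiMinus, PhiMinus, formCocycle_sum]
  refine Finset.sum_congr rfl fun i _ => ?_
  rw [formCocycle_add, formCocycle_X_mul_X (Fin.mk_le_mk.2 (by omega))]
  split_ifs
  · rw [formCocycle_add, pow_two, pow_two, formCocycle_X_mul_X le_rfl,
      formCocycle_X_mul_X le_rfl, pow_two, pow_two]
  · rw [formCocycle_zero]

/-- The tuple `(X, …, X, Y, …, Y)` of standard forms with `k` entries `X`. -/
noncomputable abbrev standardTuple (r n k : ℕ) : Fin n → MvPolynomial (Fin (2 * r)) (ZMod 2) :=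
  fun l => if (l : ℕ) < k then PhiPlus r else PhiMinus r

theorem toAdd_formDiag_standardTuple (r n k : ℕ) (v : ElemAb (2 * r)) (l : Fin n) :
    (formDiag (standardTuple r n k) v).toAdd l =
      if (l : ℕ) < k then MvPolynomial.eval v.toAdd (PhiPlus r)
      else MvPolynomial.eval v.toAdd (PhiMinus r) := by
  change formCocycle (if (l : ℕ) < k then PhiPlus r else PhiMinus r) v.toAdd v.toAdd = _
  split_ifs
  · exact formCocycle_PhiPlus_self r _
  · exact formCocycle_PhiMinus_self r _

/-! ### Values of the two forms and their inequivalence -/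

theorem eval_PhiPlus_one (x : Fin (2 * 1) → ZMod 2) :
    MvPolynomial.eval x (PhiPlus 1) = x 0 * x 1 := by
  rw [eval_PhiPlus]
  exact Fin.sum_univ_one _

theorem exists_eval_eq_one_eq_one (r : ℕ) : ∃ v : Fin (2 * (r + 1)) → ZMod 2,
    MvPolynomial.eval v (PhiPlus (r + 1)) = 1 ∧ MvPolynomial.eval v (PhiMinus (r + 1)) = 1 := by
  induction r with
  | zero =>
    refine ⟨fun _ => 1, ?_, ?_⟩
    · exact eval_PhiPlus_one _
    · exact eval_PhiMinus_one _
  | succ r ih =>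
    obtain ⟨v, h1, h2⟩ := ih
    refine ⟨(splitFirstTwo (2 * (r + 1))).symm ((0, 0), v), ?_, ?_⟩
    · rw [eval_PhiPlus_succ]
      exact (zero_add _).trans h1
    · rw [eval_PhiMinus_succ]
      exact (zero_add _).trans h2

/-- Together with `exists_eval_eq_one_eq_one`, this shows that the value pairs of the two forms span
`F₂²`. A linear condition on all values then splits into one condition for each indicator vector. -/
theorem exists_eval_eq_zero_eq_one (r : ℕ) : ∃ v : Fin (2 * (r + 1)) → ZMod 2,
    MvPolynomial.eval v (PhiPlus (r + 1)) = 0 ∧ MvPolynomial.eval v (PhiMinus (r + 1)) = 1 := by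
  induction r with
  | zero =>
    refine ⟨![1, 0], ?_, ?_⟩
    · exact eval_PhiPlus_one _
    · exact eval_PhiMinus_one _
  | succ r ih =>
    obtain ⟨v, h1, h2⟩ := ih
    refine ⟨(splitFirstTwo (2 * (r + 1))).symm ((0, 0), v), ?_, ?_⟩
    · rw [eval_PhiPlus_succ]
      exact (zero_add _).trans h1
    · rw [eval_PhiMinus_succ]
      exact (zero_add _).trans h2

/-- The sum of the two standard forms is additive. -/
theorem eval_PhiPlus_add_PhiMinus_additive (r : ℕ) (x y : Fin (2 * (r + 1)) → ZMod 2) :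
    MvPolynomial.eval (x + y) (PhiPlus (r + 1)) + MvPolynomial.eval (x + y) (PhiMinus (r + 1)) =
      (MvPolynomial.eval x (PhiPlus (r + 1)) + MvPolynomial.eval x (PhiMinus (r + 1))) +
      (MvPolynomial.eval y (PhiPlus (r + 1)) + MvPolynomial.eval y (PhiMinus (r + 1))) := by
  have h2 : (2 : ZMod 2) = 0 := rfl
  induction r with
  | zero =>
    have h1 : ∀ x : Fin (2 * 1) → ZMod 2,
        MvPolynomial.eval x (PhiPlus 1) + MvPolynomial.eval x (PhiMinus 1) = x 0 + x 1 := by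
      intro x
      rw [eval_PhiPlus_one, eval_PhiMinus_one]
      linear_combination x 0 * x 1 * h2
    refine (h1 (x + y)).trans (Eq.trans ?_ (congrArg₂ (· + ·) (h1 x) (h1 y)).symm)
    exact add_add_add_comm _ _ _ _
  | succ r ih =>
    have h1 : ∀ x : Fin (2 * (r + 1 + 1)) → ZMod 2,
        MvPolynomial.eval x (PhiPlus (r + 1 + 1)) + MvPolynomial.eval x (PhiMinus (r + 1 + 1)) =
          MvPolynomial.eval (splitFirstTwo (2 * (r + 1)) x).2 (PhiPlus (r + 1)) +
            MvPolynomial.eval (splitFirstTwo (2 * (r + 1)) x).2 (PhiMinus (r + 1)) := by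
      intro x
      rw [eval_PhiPlus_succ, eval_PhiMinus_succ, hypSum, hypSum]
      linear_combination
        (splitFirstTwo (2 * (r + 1)) x).1.1 * (splitFirstTwo (2 * (r + 1)) x).1.2 * h2
    rw [h1, h1, h1, ← ih]
    rfl

/-- The number of zeros plays the role of the Arf invariant. -/
theorem card_zeros_PhiPlus_ne_card_zeros_PhiMinus (r : ℕ) :
    Nat.card {x : Fin (2 * (r + 1)) → ZMod 2 // MvPolynomial.eval x (PhiPlus (r + 1)) = 0} ≠
      Nat.card {x : Fin (2 * (r + 1)) → ZMod 2 // MvPolynomial.eval x (PhiMinus (r + 1)) = 0} := by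
  have h1 := card_zeros_PhiPlus (r + 1)
  have h2 := card_zeros_PhiMinus r
  have h3 : 0 < 2 ^ (r + 1) := by positivity
  omega

/-- A nonzero nondegenerate form is not carried to an additive function by a linear bijection. -/
theorem IsNondegQuad.comp_ne_additive {V : Type*} [AddCommGroup V] [Module (ZMod 2) V]
    {q : V → ZMod 2} {B : LinearMap.BilinForm (ZMod 2) V} (h : IsNondegQuad q B)
    {v : V} (hv : q v = 1) (σ : V ≃+ V) : ¬ ∀ x y, q (σ (x + y)) = q (σ x) + q (σ y) := by
  intro hadd
  have : v = 0 := h.nondeg v fun y => by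
    have h1 := hadd (σ.symm v) (σ.symm y)
    rw [_root_.map_add, σ.apply_symm_apply, σ.apply_symm_apply, h.map_add] at h1
    simpa using h1
  rw [this, h.map_zero] at hv
  exact zero_ne_one hv

theorem card_zeros_comp {V : Type*} [AddCommGroup V] (q q' : V → ZMod 2) (σ : V ≃+ V)
    (h : ∀ v, q (σ v) = q' v) : Nat.card {x // q x = 0} = Nat.card {x // q' x = 0} :=
  (Nat.card_congr (σ.toEquiv.subtypeEquiv fun v => by rw [← h]; rfl)).symm

/-- Of the four combinations, zero is excluded because the form takes the value 1, the other form by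
its number of zeros, and the sum because it is additive while the polar form is nondegenerate. -/
theorem PhiPlus_comp_eq {r : ℕ} (σ : (Fin (2 * (r + 1)) → ZMod 2) ≃+ (Fin (2 * (r + 1)) → ZMod 2))
    {α β : ZMod 2} (h : ∀ v, MvPolynomial.eval (σ v) (PhiPlus (r + 1)) =
      MvPolynomial.eval v (PhiPlus (r + 1)) * α + MvPolynomial.eval v (PhiMinus (r + 1)) * β) :
    α = 1 ∧ β = 0 := by
  obtain ⟨v, hv, -⟩ := exists_eval_eq_one_eq_one r
  obtain ⟨B, hB⟩ := exists_isNondegQuad_PhiPlus (r + 1)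
  rcases zmod_two_eq_zero_or_one α with rfl | rfl <;>
    rcases zmod_two_eq_zero_or_one β with rfl | rfl
  · have := h (σ.symm v)
    rw [σ.apply_symm_apply, hv] at this
    simp at this
  · simp only [mul_zero, mul_one, zero_add] at h
    exact absurd (card_zeros_comp _ _ σ h) (card_zeros_PhiPlus_ne_card_zeros_PhiMinus r)
  · exact ⟨rfl, rfl⟩
  · simp only [mul_one] at h
    refine absurd (fun x y => ?_) (hB.comp_ne_additive hv σ)
    rw [h, h, h, eval_PhiPlus_add_PhiMinus_additive]

theorem PhiMinus_comp_eq {r : ℕ} (σ : (Fin (2 * (r + 1)) → ZMod 2) ≃+ (Fin (2 * (r + 1)) → ZMod 2))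
    {α β : ZMod 2} (h : ∀ v, MvPolynomial.eval (σ v) (PhiMinus (r + 1)) =
      MvPolynomial.eval v (PhiPlus (r + 1)) * α + MvPolynomial.eval v (PhiMinus (r + 1)) * β) :
    α = 0 ∧ β = 1 := by
  obtain ⟨v, -, hv⟩ := exists_eval_eq_one_eq_one r
  obtain ⟨B, hB⟩ := exists_isNondegQuad_PhiMinus r
  rcases zmod_two_eq_zero_or_one α with rfl | rfl <;>
    rcases zmod_two_eq_zero_or_one β with rfl | rfl
  · have := h (σ.symm v)
    rw [σ.apply_symm_apply, hv] at this
    simp at this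
  · exact ⟨rfl, rfl⟩
  · simp only [mul_zero, mul_one, add_zero] at h
    exact absurd (card_zeros_comp _ _ σ h).symm (card_zeros_PhiPlus_ne_card_zeros_PhiMinus r)
  · simp only [mul_one] at h
    refine absurd (fun x y => ?_) (hB.comp_ne_additive hv σ)
    rw [h, h, h, eval_PhiPlus_add_PhiMinus_additive]

/-- The indicator vector of the first `k` coordinates. -/
def firstOnes (n k : ℕ) : Fin n → ZMod 2 := fun l => if (l : ℕ) < k then 1 else 0

/-- The indicator vector of the coordinates from `k` on. -/
def lastOnes (n k : ℕ) : Fin n → ZMod 2 := fun l => if (l : ℕ) < k then 0 else 1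

theorem toAdd_formDiag_eq_smul_add_smul (r n k : ℕ) (v : ElemAb (2 * r)) :
    (formDiag (standardTuple r n k) v).toAdd =
      MvPolynomial.eval v.toAdd (PhiPlus r) • firstOnes n k +
        MvPolynomial.eval v.toAdd (PhiMinus r) • lastOnes n k := by
  funext l
  rw [toAdd_formDiag_standardTuple, Pi.add_apply, Pi.smul_apply, Pi.smul_apply, firstOnes, lastOnes]
  split_ifs <;> simp

/-- Bijections of the source that agree with an additive map of the target on a tuple of standard
forms preserve the tuple. -/
theorem formDiag_comp_eq {r n k : ℕ} (σ : MulAut (ElemAb (2 * (r + 1)))) (τ : MulAut (ElemAb n))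
    (h : ∀ v, formDiag (standardTuple (r + 1) n k) (σ v) =
      τ (formDiag (standardTuple (r + 1) n k) v)) (v : ElemAb (2 * (r + 1))) :
    formDiag (standardTuple (r + 1) n k) (σ v) = formDiag (standardTuple (r + 1) n k) v := by
  let σ' : (Fin (2 * (r + 1)) → ZMod 2) ≃+ (Fin (2 * (r + 1)) → ZMod 2) :=
    MulAutMultiplicative _ σ |>.toAdd
  let τ' : (Fin n → ZMod 2) →+ (Fin n → ZMod 2) := (MulAutMultiplicative _ τ).toAdd.toAddMonoidHom
  -- By linearity of `τ`, each coordinate after `σ` is a combination of the two forms with constant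
  -- coefficients, the situation of `PhiPlus_comp_eq` and `PhiMinus_comp_eq`.
  have hlin : ∀ x l, (formDiag (standardTuple (r + 1) n k) (σ x)).toAdd l =
      MvPolynomial.eval x.toAdd (PhiPlus (r + 1)) * τ' (firstOnes n k) l +
        MvPolynomial.eval x.toAdd (PhiMinus (r + 1)) * τ' (lastOnes n k) l := by
    intro x l
    rw [h]
    change τ' (formDiag (standardTuple (r + 1) n k) x).toAdd l = _
    rw [toAdd_formDiag_eq_smul_add_smul, map_add, ZMod.map_smul τ', ZMod.map_smul τ']
    rfl
  apply Multiplicative.toAdd.injective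
  funext l
  have h1 := fun x => hlin x l
  simp only [toAdd_formDiag_standardTuple] at h1
  rw [hlin, toAdd_formDiag_standardTuple]
  split_ifs at h1 ⊢ with hl
  · obtain ⟨h3, h4⟩ := PhiPlus_comp_eq σ' fun x => h1 (Multiplicative.ofAdd x)
    rw [h3, h4, mul_one, mul_zero, add_zero]
  · obtain ⟨h3, h4⟩ := PhiMinus_comp_eq σ' fun x => h1 (Multiplicative.ofAdd x)
    rw [h3, h4, mul_one, mul_zero, zero_add]

/-! ### Membership in the isotropy groups -/

section Isotropy

variable {r n k : ℕ} {G : Type*} [Group G] (E : GroupExtension (ElemAb n) G (ElemAb (2 * r)))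
  (hE : E.inl.range ≤ Subgroup.center G) (hclass : E.extClass hE = formClass (standardTuple r n k))
include hclass

theorem smul_extClass_eq_iff (p : MulAut (ElemAb (2 * r)) × MulAut (ElemAb n)) :
    p • E.extClass hE = E.extClass hE ↔ ∀ v, p.2 (formDiag (standardTuple r n k) (p.1⁻¹ v)) =
      formDiag (standardTuple r n k) v := by
  rw [hclass]
  conv_lhs => rw [← one_smul (MulAut (ElemAb (2 * r)) × MulAut (ElemAb n))
    (formClass (standardTuple r n k)), smul_smul, mul_one]
  exact smul_formClass_eq_smul_iff _ p 1

theorem mem_comap_isotropyQ_iff (A : GL (Fin (2 * r)) (ZMod 2)) :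
    A ∈ (E.isotropyQ hE).comap (colAut (2 * r)) ↔
      ∀ (v : Fin (2 * r) → ZMod 2) (l : Fin n),
        MvPolynomial.eval (A.val.mulVec v) (standardTuple r n k l) =
          MvPolynomial.eval v (standardTuple r n k l) := by
  -- The action pulls back along the inverse, so passing to `A⁻¹` leaves the form evaluated at `A
  -- v`.
  rw [← inv_mem_iff]
  refine (smul_extClass_eq_iff E hE hclass (colAut (2 * r) A⁻¹, 1)).trans ?_
  have h1 : ∀ v : Fin (2 * r) → ZMod 2, (colAut (2 * r) A⁻¹)⁻¹ (Multiplicative.ofAdd v) =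
      Multiplicative.ofAdd (A.val.mulVec v) := fun v => by
    rw [← map_inv, inv_inv]
    rfl
  have h2 : ∀ (v : Fin (2 * r) → ZMod 2) (l : Fin n),
      (formDiag (standardTuple r n k) (Multiplicative.ofAdd v)).toAdd l =
        MvPolynomial.eval v (standardTuple r n k l) := by
    intro v l
    rw [toAdd_formDiag_standardTuple]
    simp only [standardTuple]
    split_ifs <;> rfl
  constructor
  · intro h v l
    have h3 := congrFun (congrArg Multiplicative.toAdd (h (Multiplicative.ofAdd v))) l
    rw [h1] at h3
    rw [← h2, ← h2]
    exact h3
  · intro h v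
    apply Multiplicative.toAdd.injective
    funext l
    have h3 := h v.toAdd l
    rw [← h2, ← h2, ← h1] at h3
    exact h3

theorem mem_comap_isotropyN_iff (T : GL (Fin n) (ZMod 2)) :
    T ∈ (E.isotropyN hE).comap (rowAut n) ↔
      ∀ v : Fin (2 * r) → ZMod 2,
        Matrix.vecMul (MvPolynomial.eval v (PhiPlus r) • firstOnes n k +
          MvPolynomial.eval v (PhiMinus r) • lastOnes n k) T⁻¹.val =
        MvPolynomial.eval v (PhiPlus r) • firstOnes n k +
          MvPolynomial.eval v (PhiMinus r) • lastOnes n k := by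
  refine (smul_extClass_eq_iff E hE hclass (1, rowAut n T)).trans ?_
  constructor
  · intro h v
    have h3 := congrArg Multiplicative.toAdd (h (Multiplicative.ofAdd v))
    rw [toAdd_formDiag_eq_smul_add_smul] at h3
    rw [inv_one] at h3
    change Matrix.vecMul (formDiag (standardTuple r n k) (Multiplicative.ofAdd v)).toAdd _ = _ at h3
    rw [toAdd_formDiag_eq_smul_add_smul] at h3
    exact h3
  · intro h v
    apply Multiplicative.toAdd.injective
    rw [inv_one]
    change Matrix.vecMul (formDiag (standardTuple r n k) v).toAdd _ = _
    rw [toAdd_formDiag_eq_smul_add_smul]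
    exact h v.toAdd

end Isotropy

/-- A point `σ[E] = τ[E]` of both orbits says that precomposing the quadratic map with `σ⁻¹` equals
applying `τ` to its values. By `formDiag_comp_eq` such a `σ⁻¹` already preserves the map. -/
theorem Omega_eq_singleton {r n k : ℕ} {G : Type*} [Group G]
    (E : GroupExtension (ElemAb n) G (ElemAb (2 * (r + 1))))
    (hE : E.inl.range ≤ Subgroup.center G)
    (hclass : E.extClass hE = formClass (standardTuple (r + 1) n k)) :
    E.Omega hE = {E.extClass hE} := by
  ext c
  constructor
  · rintro ⟨⟨σ, rfl⟩, τ, hτ⟩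
    have h1 : ((1, τ) : MulAut (ElemAb (2 * (r + 1))) × MulAut (ElemAb n)) • formClass (standardTuple (r + 1) n k) =
        ((σ, 1) : MulAut (ElemAb (2 * (r + 1))) × MulAut (ElemAb n)) • formClass (standardTuple (r + 1) n k) := by
      rw [← hclass]
      exact hτ
    have h2 := (smul_formClass_eq_smul_iff _ _ _).1 h1
    refine (smul_extClass_eq_iff E hE hclass (σ, 1)).2 fun v => ?_
    refine formDiag_comp_eq σ⁻¹ τ (fun x => ?_) v
    have h3 := h2 x
    rw [inv_one] at h3
    exact h3.symm
  · rintro rfl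
    exact ⟨⟨1, one_smul _ _⟩, 1, one_smul _ _⟩

/-! ## Orders of the isotropy groups -/

theorem card_comap_of_bijective {H K : Type*} [Group H] [Group K] (f : H →* K)
    (hf : Function.Bijective f) (L : Subgroup K) : Nat.card (L.comap f) = Nat.card L :=
  Nat.card_congr ((Equiv.ofBijective f hf).subtypeEquiv fun _ => Iff.rfl)

theorem SubgroupConj.card_eq {H : Type*} [Group H] {K L : Subgroup H} (h : SubgroupConj K L) :
    Nat.card K = Nat.card L := by
  obtain ⟨g, rfl⟩ := h
  exact Nat.card_congr (K.equivMapOfInjective _ (MulAut.conj g).injective).toEquiv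

theorem not_isPGroup_two_of_three_dvd {H : Type*} [Group H] [Finite H] (h : 3 ∣ Nat.card H) :
    ¬ IsPGroup 2 H := by
  intro hp
  have : Fact (Nat.Prime 2) := ⟨Nat.prime_two⟩
  obtain ⟨e, he⟩ := IsPGroup.iff_card.1 hp
  rw [he] at h
  exact absurd (Nat.prime_three.dvd_of_dvd_pow h) (by norm_num)

theorem isPGroup_two_of_card_dvd {H : Type*} [Group H] {e : ℕ} (h : Nat.card H ∣ 2 ^ e) :
    IsPGroup 2 H := by
  obtain ⟨d, -, hd⟩ := (Nat.dvd_prime_pow Nat.prime_two).1 h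
  exact IsPGroup.of_card hd

/-- The factor at `i = 2` is 6. -/
theorem three_dvd_prod_GL {k : ℕ} (hk : 2 ≤ k) :
    3 ∣ ∏ i ∈ Finset.Icc 1 k, ((2 ^ i - 1) * 2 ^ (i - 1)) :=
  Dvd.dvd.trans (by norm_num) (Finset.dvd_prod_of_mem _ (Finset.mem_Icc.2 ⟨one_le_two, hk⟩))

/-- The factor at `i = 1` is 12. -/
theorem three_dvd_prod_orthogonal {r : ℕ} (hr : 1 ≤ r) :
    3 ∣ ∏ i ∈ Finset.Icc 1 r, ((2 ^ (2 * i) - 1) * 2 ^ (2 * i)) :=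
  Dvd.dvd.trans (by norm_num) (Finset.dvd_prod_of_mem _ (Finset.mem_Icc.2 ⟨le_rfl, hr⟩))

instance finite_mulAut_elemAb (d : ℕ) : Finite (MulAut (ElemAb d)) :=
  Finite.of_injective (fun σ : MulAut (ElemAb d) => (σ : ElemAb d → ElemAb d))
    DFunLike.coe_injective

/-! ### The isotropy groups in the three cases -/

section Isotropy

variable {r n k : ℕ} {G : Type*} [Group G] (E : GroupExtension (ElemAb n) G (ElemAb (2 * (r + 1))))
  (hE : E.inl.range ≤ Subgroup.center G)
  (hclass : E.extClass hE = formClass (standardTuple (r + 1) n k))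
include hclass

/-- The isotropy group of the kernel fixes the indicator vectors of the two kinds of coordinates. -/
theorem mem_comap_isotropyN_iff_fixes (T : GL (Fin n) (ZMod 2)) :
    T ∈ (E.isotropyN hE).comap (rowAut n) ↔
      Matrix.vecMul (firstOnes n k) T⁻¹.val = firstOnes n k ∧
      Matrix.vecMul (lastOnes n k) T⁻¹.val = lastOnes n k := by
  rw [mem_comap_isotropyN_iff E hE hclass]
  constructor
  · intro h
    obtain ⟨v, hv, hv'⟩ := exists_eval_eq_one_eq_one r
    obtain ⟨w, hw, hw'⟩ := exists_eval_eq_zero_eq_one r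
    have h1 := h w
    rw [hw, hw', zero_smul, zero_add, one_smul] at h1
    have h2 := h v
    rw [hv, hv', one_smul, one_smul, Matrix.add_vecMul, h1] at h2
    exact ⟨add_right_cancel h2, h1⟩
  · rintro ⟨h1, h2⟩ v
    rw [Matrix.add_vecMul, Matrix.smul_vecMul, Matrix.smul_vecMul, h1, h2]

theorem isotropyQ_eq_OPlus (hn : 1 ≤ n) (hk : k = n) :
    (E.isotropyQ hE).comap (colAut (2 * (r + 1))) = OPlus (r + 1) := by
  subst hk
  ext A
  rw [mem_comap_isotropyQ_iff E hE hclass]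
  have h1 : ∀ l : Fin k, standardTuple (r + 1) k k l = PhiPlus (r + 1) := fun l => if_pos l.2
  simp only [h1]
  exact ⟨fun h v => h v ⟨0, hn⟩, fun h v _ => h v⟩

theorem isotropyQ_eq_OMinus (hn : 1 ≤ n) (hk : k = 0) :
    (E.isotropyQ hE).comap (colAut (2 * (r + 1))) = OMinus (r + 1) := by
  subst hk
  ext A
  rw [mem_comap_isotropyQ_iff E hE hclass]
  have h1 : ∀ l : Fin n, standardTuple (r + 1) n 0 l = PhiMinus (r + 1) :=
    fun l => if_neg (Nat.not_lt_zero _)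
  simp only [h1]
  exact ⟨fun h v => h v ⟨0, hn⟩, fun h v _ => h v⟩

theorem isotropyQ_eq_inf (hk : 1 ≤ k) (hkn : k < n) :
    (E.isotropyQ hE).comap (colAut (2 * (r + 1))) = OPlus (r + 1) ⊓ OMinus (r + 1) := by
  ext A
  rw [mem_comap_isotropyQ_iff E hE hclass]
  constructor
  · refine fun h => ⟨fun v => ?_, fun v => ?_⟩
    · have h1 := h v ⟨0, by omega⟩
      rwa [standardTuple, if_pos (Nat.lt_of_lt_of_le Nat.zero_lt_one hk)] at h1
    · have h1 := h v ⟨k, hkn⟩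
      rwa [standardTuple, if_neg (lt_irrefl _)] at h1
  · intro h v l
    simp only [standardTuple]
    split_ifs
    · exact h.1 v
    · exact h.2 v

theorem isotropyN_conj_of_eq (hn : 1 ≤ n) (hk : k = n) :
    SubgroupConj ((E.isotropyN hE).comap (rowAut n)) (lowerParabolic n 1) := by
  subst hk
  refine subgroupConj_lowerParabolic (fun _ => firstOnes k k) ?_ _ fun T => ?_
  · rw [linearIndependent_unique_iff]
    intro h
    have h0 := congrFun h ⟨0, hn⟩
    have hk : 0 < k := hn
    simp [firstOnes, hk] at h0
  · rw [mem_comap_isotropyN_iff_fixes E hE hclass]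
    have h0 : lastOnes k k = 0 := funext fun l => if_pos l.2
    rw [h0, Matrix.zero_vecMul]
    simp

theorem isotropyN_conj_of_eq_zero (hn : 1 ≤ n) (hk : k = 0) :
    SubgroupConj ((E.isotropyN hE).comap (rowAut n)) (lowerParabolic n 1) := by
  subst hk
  refine subgroupConj_lowerParabolic (fun _ => lastOnes n 0) ?_ _ fun T => ?_
  · rw [linearIndependent_unique_iff]
    intro h
    exact one_ne_zero (α := ZMod 2) (congrFun h ⟨0, hn⟩)
  · rw [mem_comap_isotropyN_iff_fixes E hE hclass]
    have h0 : firstOnes n 0 = 0 := funext fun l => if_neg (Nat.not_lt_zero _)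
    rw [h0, Matrix.zero_vecMul]
    simp

theorem isotropyN_conj_of_lt (hk : 1 ≤ k) (hkn : k < n) :
    SubgroupConj ((E.isotropyN hE).comap (rowAut n)) (lowerParabolic n 2) := by
  refine subgroupConj_lowerParabolic ![firstOnes n k, lastOnes n k] ?_ _ fun T => ?_
  · rw [LinearIndependent.pair_iff]
    intro s t hst
    -- Coordinate `0` lies in the first block and coordinate `k` in the second, so they isolate the
    -- two coefficients.
    have h1 := congrFun hst ⟨0, by omega⟩
    have h2 := congrFun hst ⟨k, hkn⟩
    have hk' : 0 < k := hk
    simpa [firstOnes, lastOnes, hk'] using And.intro h1 h2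
  · rw [mem_comap_isotropyN_iff_fixes E hE hclass, Fin.forall_fin_two]
    rfl

end Isotropy

/-! ### The main theorem -/

theorem theorem6p2 (r n k : ℕ) (hr : 1 ≤ r) (hn : 1 ≤ n) (hk : k ≤ n)
    {G : Type*} [Group G] (E : GroupExtension (ElemAb n) G (ElemAb (2 * r)))
    (hE : E.inl.range ≤ Subgroup.center G)
    (hclass : E.extClass hE =
      formClass (fun l : Fin n => if (l : ℕ) < k then PhiPlus r else PhiMinus r)) :
    E.Omega hE = {E.extClass hE} ∧
    Nat.card E.rho.range = Nat.card (E.isotropyQ hE) * Nat.card (E.isotropyN hE) ∧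
    (k = n →
      (E.isotropyQ hE).comap (colAut (2 * r)) = OPlus r ∧
      Nat.card (E.isotropyQ hE) =
        2 * (2 ^ r - 1) * ∏ i ∈ Finset.Icc 1 (r - 1), ((2 ^ (2 * i) - 1) * 2 ^ (2 * i)) ∧
      SubgroupConj ((E.isotropyN hE).comap (rowAut n)) (lowerParabolic n 1) ∧
      Nat.card (E.isotropyN hE) = 2 ^ (n - 1) * ∏ i ∈ Finset.Icc 1 (n - 1), ((2 ^ i - 1) * 2 ^ (i - 1)) ∧
      (IsPGroup 2 E.rho.range ↔ 2 * r < 3 ∧ n < 3)) ∧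
    (k = 0 →
      (E.isotropyQ hE).comap (colAut (2 * r)) = OMinus r ∧
      Nat.card (E.isotropyQ hE) =
        2 * (2 ^ r + 1) * ∏ i ∈ Finset.Icc 1 (r - 1), ((2 ^ (2 * i) - 1) * 2 ^ (2 * i)) ∧
      SubgroupConj ((E.isotropyN hE).comap (rowAut n)) (lowerParabolic n 1) ∧
      (IsPGroup 2 E.rho.range ↔ 2 * r < 2 ∧ n < 3)) ∧
    (1 ≤ k → k < n →
      (E.isotropyQ hE).comap (colAut (2 * r)) = OPlus r ⊓ OMinus r ∧
      SubgroupConj ((E.isotropyN hE).comap (rowAut n)) (lowerParabolic n 2) ∧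
      Nat.card (E.isotropyN hE) =
        2 ^ (2 * (n - 2)) * ∏ i ∈ Finset.Icc 1 (n - 2), ((2 ^ i - 1) * 2 ^ (i - 1)) ∧
      (IsPGroup 2 E.rho.range ↔ 2 * r < 4 ∧ n < 4)) := by
  obtain ⟨r, rfl⟩ : ∃ r', r = r' + 1 := ⟨r - 1, by omega⟩
  rw [Nat.add_sub_cancel]
  have hΩ := Omega_eq_singleton E hE hclass
  have hcard := E.card_range_rho hE hΩ
  have hQ := card_comap_of_bijective _ (colAut_bijective (2 * (r + 1))) (E.isotropyQ hE)
  have hN := card_comap_of_bijective _ (rowAut_bijective n) (E.isotropyN hE)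
  refine ⟨hΩ, hcard, fun hkn => ?_, fun hk0 => ?_, fun hk1 hkn => ?_⟩
  · have h1 := isotropyQ_eq_OPlus E hE hclass hn hkn
    have h2 := isotropyN_conj_of_eq E hE hclass hn hkn
    rw [h1, card_OPlus] at hQ
    rw [h2.card_eq, card_lowerParabolic hn, one_mul] at hN
    refine ⟨h1, hQ.symm, h2, hN.symm, fun hp => ?_, fun ⟨hr', hn'⟩ => ?_⟩
    · by_contra hc
      refine not_isPGroup_two_of_three_dvd ?_ hp
      rw [hcard, ← hQ, ← hN]
      -- After the shift of `r`, `1 ≤ r` means `m ≥ 4`, where 3 divides the orthogonal factor.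
      -- Otherwise `n ≥ 3` and 3 divides the order of `GL_{n-1}`.
      by_cases hr1 : 1 ≤ r
      · exact Dvd.dvd.mul_right ((three_dvd_prod_orthogonal hr1).mul_left _) _
      · exact Dvd.dvd.mul_left ((three_dvd_prod_GL (by omega)).mul_left _) _
    · obtain rfl : r = 0 := by omega
      -- For `m = 2` the orthogonal factor is 2, and for `n ≤ 2` the other factor is 1 or 2.
      refine isPGroup_two_of_card_dvd (e := 2) ?_
      rw [hcard, ← hQ, ← hN]
      interval_cases n <;> simp
  · have h1 := isotropyQ_eq_OMinus E hE hclass hn hk0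
    have h2 := isotropyN_conj_of_eq_zero E hE hclass hn hk0
    rw [h1, card_OMinus] at hQ
    refine ⟨h1, hQ.symm, h2, fun hp => ?_, fun ⟨hr', _⟩ => by omega⟩
    refine absurd hp (not_isPGroup_two_of_three_dvd ?_)
    rw [hcard, ← hQ]
    refine Dvd.dvd.mul_right ?_ _
    -- Even for `m = 2` the group `O_2^-` has order 6.
    rcases Nat.eq_zero_or_pos r with rfl | hr1
    · norm_num
    · exact (three_dvd_prod_orthogonal hr1).mul_left _
  · have h1 := isotropyQ_eq_inf E hE hclass hk1 hkn
    have h2 := isotropyN_conj_of_lt E hE hclass hk1 hkn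
    rw [h1] at hQ
    rw [h2.card_eq, card_lowerParabolic (by omega)] at hN
    refine ⟨h1, h2, hN.symm, fun hp => ?_, fun ⟨hr', hn'⟩ => ?_⟩
    · by_contra hc
      refine not_isPGroup_two_of_three_dvd ?_ hp
      rw [hcard, ← hQ, ← hN]
      by_cases hr1 : 1 ≤ r
      · obtain ⟨r, rfl⟩ : ∃ r', r = r' + 1 := ⟨r - 1, by omega⟩
        exact Dvd.dvd.mul_right (three_dvd_card_OPlus_inf_OMinus r) _
      · exact Dvd.dvd.mul_left ((three_dvd_prod_GL (by omega)).mul_left _) _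
    · obtain rfl : r = 0 := by omega
      -- For `m = 2` the bound by the order 2 of `O_2^+` suffices. With `n = 2` or `3` the other
      -- factor is 1 or 4, whence the exponent 3 below.
      have h3 : Nat.card (OPlus (0 + 1) ⊓ OMinus (0 + 1) :
          Subgroup (GL (Fin (2 * (0 + 1))) (ZMod 2))) ∣ 2 :=
        (Subgroup.card_dvd_of_le inf_le_left).trans (by rw [card_OPlus]; simp)
      refine isPGroup_two_of_card_dvd (e := 3) ?_
      rw [hcard, ← hQ, ← hN]
      refine (mul_dvd_mul_right h3 _).trans ?_
      have hn2 : 2 ≤ n := by omega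
      interval_cases n <;> simp
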